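/- **Theorem.** Consider unoriented link diagrams in $\mathbb{R}^2$ or in $S^2$ (generic immersed closed curves with over/under information at the double points; a link has at least one component). Two diagrams are *equivalent* if they are ambient isotopic in $\mathbb{R}^2$ (respectively $S^2$). Write $\mathrm{RI}_-$ for the Reidemeister move I that removes one crossing (it removes a kink, i.e. a loop of the curve bounding a monogonal region), and $\mathrm{RII}_-$ for the Reidemeister move II that removes two crossings (it pulls apart two strands bounding a bigonal region, one of them passing over the other at both corners of the bigon). Call a diagram *minimal* if neither $\mathrm{RI}_-$ nor $\mathrm{RII}_-$ can be applied to it. Let $D$ be a diagram, in $\mathbb{R}^2$ or in $S^2$, of a link without a split unknot component, i.e. a link having no diagram in which some component has no crossings and at least one other component is present. If $D_1$ and $D_2$ are minimal diagrams, each obtained from $D$ by applying finitely many (possibly zero) moves $\mathrm{RI}_-$ and $\mathrm{RII}_-$, then $D_1$ and $D_2$ are equivalent. -/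

import Mathlib

/-!
Link diagrams in the plane or on the sphere, in combinatorial form.

A link diagram is a closed curve system with finitely many transverse double points, together with
over/under information, considered up to ambient isotopy of the surface.  It is recorded as a graph
drawn on the surface: the vertices are the crossings (4-valent) and finitely many auxiliary bivalent
points on the curves.  Every closed curve carries at least one vertex, so a crossingless circle
carries only bivalent points.  Adding or forgetting auxiliary points is part of the notion of
isotopy.  A drawn graph, connected or not, is determined up to orientation-preserving
homeomorphism by the cyclic order of the edge ends at each vertex, the pairing of edge ends into
edges, and the knowledge of which sides of edges belong to the same region.
-/

/-- The two surfaces in which diagrams are drawn. -/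
inductive Ambient where
  | plane
  | sphere

/-- A (nonempty, unoriented) link diagram in the plane or on the sphere. A plane diagram is a
diagram on the sphere together with the region that contains the point at infinity. -/
structure LinkDiagram (X : Ambient) where
  /-- Darts, i.e. edge ends, pointing away from their vertex. -/
  Dart : Type
  finite : Finite Dart
  nonempty : Nonempty Dart
  /-- The other end of the same edge. -/
  α : Equiv.Perm Dart
  α_α : ∀ x, α (α x) = x
  α_ne : ∀ x, α x ≠ x
  /-- The next dart at the same vertex, counterclockwise. -/
  σ : Equiv.Perm Dart
  σ_ne : ∀ x, σ x ≠ x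
  /-- With `σ_ne`: every vertex has valency 2 or 4. -/
  σ_four : ∀ x, σ (σ (σ (σ x))) = x
  /-- At a crossing: does the dart belong to the over-strand? (No meaning at bivalent points.) -/
  isOver : Dart → Bool
  isOver_σ : ∀ x, σ (σ x) ≠ x → isOver (σ x) = !isOver x
  /-- `reg x y`: the regions on the left of `x` and on the left of `y` are the same. The region on
  the left of `x` contains the corner from `x` to `σ x`, and it lies on the right of `α x`. -/
  reg : Setoid Dart
  reg_corner : ∀ x, reg (α (σ x)) x
  /-- The surface is connected: any two regions are joined by a path that crosses edges. -/
  connected : ∀ x y, Relation.EqvGen (fun a b => b = α a ∨ reg a b) x y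
  /-- The surface is a sphere: every mod 2 cycle `S` of the graph (a set of edges that has even
  degree at each vertex) separates it, i.e. is the boundary of a union `f` of regions. (Regions are
  spheres with holes; equivalently `V - E - F + 2 * R = 2`, with `F` boundary walks, `R` regions.) -/
  jordan : ∀ S : Dart → ZMod 2, (∀ x, S (α x) = S x) →
    (∀ x, σ (σ x) = x → S x + S (σ x) = 0) →
    (∀ x, σ (σ x) ≠ x → S x + S (σ x) + S (σ (σ x)) + S (σ (σ (σ x))) = 0) →
    ∃ f : Dart → ZMod 2, (∀ x y, reg x y → f x = f y) ∧ ∀ x, f x + f (α x) = S x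
  /-- The region on the left of the dart contains the point at infinity. -/
  outer : Dart → Prop
  outer_spec : match X with
    | .plane => ∃ x, ∀ y, outer y ↔ reg x y
    | .sphere => ∀ y, ¬ outer y

namespace LinkDiagram

/-- The vertex of the dart is a crossing. -/
def IsCrossing {X : Ambient} (D : LinkDiagram X) (x : D.Dart) : Prop := D.σ (D.σ x) ≠ x

/-- Isomorphism of diagrams: an orientation-preserving homeomorphism of the surface (fixing the
point at infinity in the plane case) that carries one diagram, with its vertices, to the other. -/
def Iso {X : Ambient} (D D' : LinkDiagram X) : Prop :=
  ∃ e : D.Dart ≃ D'.Dart,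
    (∀ x, D'.α (e x) = e (D.α x)) ∧
    (∀ x, D'.σ (e x) = e (D.σ x)) ∧
    (∀ x, D.IsCrossing x → D'.isOver (e x) = D.isOver x) ∧
    (∀ x y, D'.reg (e x) (e y) ↔ D.reg x y) ∧
    (∀ x, D'.outer (e x) ↔ D.outer x)

/-- `D'` arises from `D` by placing one more bivalent point, with darts `u` and `v`, on the edge
of the dart `x`. (The regions beside `u` and `v` are determined by `reg_corner`.) -/
def Subdivides {X : Ambient} (D D' : LinkDiagram X) : Prop :=
  ∃ (x : D.Dart) (u v : D'.Dart) (i : D.Dart → D'.Dart),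
    Function.Injective i ∧ u ≠ v ∧ Set.range i = {u, v}ᶜ ∧
    D'.σ u = v ∧ D'.σ v = u ∧
    (∀ z, D'.σ (i z) = i (D.σ z)) ∧
    D'.α (i x) = u ∧ D'.α (i (D.α x)) = v ∧
    (∀ z, z ≠ x → z ≠ D.α x → D'.α (i z) = i (D.α z)) ∧
    (∀ z, D.IsCrossing z → D'.isOver (i z) = D.isOver z) ∧
    (∀ y z, D'.reg (i y) (i z) ↔ D.reg y z) ∧
    (∀ z, D'.outer (i z) ↔ D.outer z)

/-- Equivalence of diagrams, i.e. ambient isotopy in the plane or the sphere. -/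
def Isotopic {X : Ambient} : LinkDiagram X → LinkDiagram X → Prop :=
  Relation.EqvGen (fun D D' => Iso D D' ∨ Subdivides D D')

/-- The classes of `a` and `b` are united. -/
def glue {T : Type} (r : Setoid T) (a b : T) : Setoid T where
  r y z := r y z ∨ ((r y a ∨ r y b) ∧ (r z a ∨ r z b))
  iseqv :=
    { refl := fun y => Or.inl (r.refl y)
      symm := by
        rintro y z (h | ⟨h, k⟩)
        · exact Or.inl (r.symm h)
        · exact Or.inr ⟨k, h⟩
      trans := by
        rintro y z w (h | ⟨h, k⟩) (h' | ⟨h', k'⟩)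
        · exact Or.inl (r.trans h h')
        · exact Or.inr ⟨h'.imp (r.trans h) (r.trans h), k'⟩
        · exact Or.inr ⟨h, k.imp (r.trans (r.symm h')) (r.trans (r.symm h'))⟩
        · exact Or.inr ⟨h, k'⟩ }

open Classical in
theorem smooth_apply {T : Type} (s : Equiv.Perm T) (x z : T) :
    (s * Equiv.swap x (s (s x))) z =
      if z = x then s (s (s x)) else if z = s (s x) then s x else s z := by
  simp only [Equiv.Perm.mul_apply, Equiv.swap_apply_def]
  split_ifs <;> rfl

open Classical in
theorem smooth_even {T : Type} (s : Equiv.Perm T) (hne : ∀ z, s z ≠ z)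
    (hs : ∀ z, s (s (s (s z))) = z) (x : T) (S : T → ZMod 2)
    (h2 : ∀ z, (s * Equiv.swap x (s (s x))) ((s * Equiv.swap x (s (s x))) z) = z →
      S z + S ((s * Equiv.swap x (s (s x))) z) = 0)
    (h4 : ∀ z, (s * Equiv.swap x (s (s x))) ((s * Equiv.swap x (s (s x))) z) ≠ z →
      S z + S ((s * Equiv.swap x (s (s x))) z)
        + S ((s * Equiv.swap x (s (s x))) ((s * Equiv.swap x (s (s x))) z))
        + S ((s * Equiv.swap x (s (s x))) ((s * Equiv.swap x (s (s x)))
          ((s * Equiv.swap x (s (s x))) z))) = 0) :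
    S (s x) = S (s (s x)) ∧ (∀ z, s (s z) = z → S z + S (s z) = 0) ∧
      ∀ z, s (s z) ≠ z → S z + S (s z) + S (s (s z)) + S (s (s (s z))) = 0 := by
  have cancel : ∀ a b : ZMod 2, a + b = 0 → a = b := by decide
  have inj : ∀ a b, s a = s b → a = b := fun a b h => s.injective h
  by_cases hx : s (s x) = x
  · simp only [hx, Equiv.swap_self] at h2 h4
    refine ⟨?_, h2, h4⟩
    have := h2 x hx
    rw [hx]
    exact (cancel _ _ this).symm
  have t0 : (s * Equiv.swap x (s (s x))) x = s (s (s x)) := by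
    rw [smooth_apply, if_pos rfl]
  have t2 : (s * Equiv.swap x (s (s x))) (s (s x)) = s x := by
    rw [smooth_apply, if_neg hx, if_pos rfl]
  have tz : ∀ z, z ≠ x → z ≠ s (s x) → (s * Equiv.swap x (s (s x))) z = s z := fun z h h' => by
    rw [smooth_apply, if_neg h, if_neg h']
  have t1 : (s * Equiv.swap x (s (s x))) (s x) = s (s x) := tz _ (hne x) (fun h => hne _ h.symm)
  have t3 : (s * Equiv.swap x (s (s x))) (s (s (s x))) = x := by
    rw [tz _ (fun h => hne x (by have := hs x; rwa [h] at this)) (hne _), hs]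
  generalize s * Equiv.swap x (s (s x)) = t at *
  have hA : S x = S (s (s (s x))) := by
    have := h2 x (by rw [t0, t3])
    rw [t0] at this
    exact cancel _ _ this
  have hB : S (s x) = S (s (s x)) := by
    have := h2 (s x) (by rw [t1, t2])
    rw [t1] at this
    exact cancel _ _ this
  have e1 : ∀ a b : ZMod 2, a + b + b + a = 0 := by decide
  have e2 : ∀ a b : ZMod 2, a + a + b + b = 0 := by decide
  refine ⟨hB, fun z hz => ?_, fun z hz => ?_⟩
  · have n0 : z ≠ x := fun h => hx (h ▸ hz)
    have n1 : z ≠ s (s x) := fun h => hx (inj _ _ (inj _ _ (h ▸ hz)))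
    have n2 : s z ≠ x := fun h => hx (by rw [← h, hz])
    have n3 : s z ≠ s (s x) := fun h => hx (by
      have h' := inj _ _ h
      rw [h'] at hz
      exact inj _ _ hz)
    have := h2 z (by rw [tz z n0 n1, tz _ n2 n3, hz])
    rwa [tz z n0 n1] at this
  · by_cases hz1 : z = x
    · rw [hz1, hA, hB]; exact e1 _ _
    by_cases hz2 : z = s x
    · rw [hz2, hs, hA, hB]; exact e2 _ _
    by_cases hz3 : z = s (s x)
    · rw [hz3, hs, hA, hB]; exact e1 _ _
    by_cases hz4 : z = s (s (s x))
    · rw [hz4, hs, hA, hB]; exact e2 _ _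
    have n1 : s z ≠ x := fun h => hz4 (by rw [← h, hs])
    have n2 : s z ≠ s (s x) := fun h => hz2 (inj _ _ h)
    have n3 : s (s z) ≠ x := fun h => hz3 (by rw [← h, hs])
    have n4 : s (s z) ≠ s (s x) := fun h => hz1 (inj _ _ (inj _ _ h))
    have := h4 z
    rw [tz z hz1 hz3, tz _ n1 n2, tz _ n3 n4] at this
    exact this hz

open Classical in
/-- Smoothing of the crossing at `x` that opens a channel from the corner between `x` and `σ x` to
the opposite corner. The crossing is replaced by two bivalent points, one with darts `σ x`, `σ² x`
and one with darts `σ³ x`, `x`, and the regions at the two corners are united.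
(If `x` is at a bivalent point, nothing changes.) -/
noncomputable def smooth {X : Ambient} (D : LinkDiagram X) (x : D.Dart) : LinkDiagram X where
  Dart := D.Dart
  finite := D.finite
  nonempty := D.nonempty
  α := D.α
  α_α := D.α_α
  α_ne := D.α_ne
  σ := D.σ * Equiv.swap x (D.σ (D.σ x))
  σ_ne z := by
    have h := D.σ_ne
    have h4 := D.σ_four
    have inj := D.σ.injective
    rw [smooth_apply]
    split_ifs with h1 h2
    · subst h1
      intro h0
      have := h4 z
      rw [h0] at this
      exact h z this
    · subst h2
      exact fun h0 => h _ h0.symm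
    · exact h z
  σ_four z := by
    have h4 := D.σ_four
    have inj : ∀ a b, D.σ a = D.σ b → a = b := fun a b h => D.σ.injective h
    simp only [smooth_apply]
    grind
  isOver := D.isOver
  isOver_σ z := by
    have h4 := D.σ_four
    have ho := D.isOver_σ
    have inj : ∀ a b, D.σ a = D.σ b → a = b := fun a b h => D.σ.injective h
    simp only [smooth_apply]
    grind
  reg := glue D.reg x (D.σ (D.σ x))
  reg_corner z := by
    have hc := D.reg_corner
    have h4 := D.σ_four x
    rw [smooth_apply]
    split_ifs with h1 h2
    · subst h1
      exact Or.inr ⟨Or.inr (hc _), Or.inl (D.reg.refl _)⟩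
    · subst h2
      exact Or.inr ⟨Or.inl (hc _), Or.inr (D.reg.refl _)⟩
    · exact Or.inl (hc z)
  connected y z := by
    refine (D.connected y z).mono ?_
    rintro a b (h | h)
    · exact Or.inl h
    · exact Or.inr (Or.inl h)
  jordan S hα h2 h4 := by
    obtain ⟨hB, g2, g4⟩ := smooth_even D.σ D.σ_ne D.σ_four x S h2 h4
    obtain ⟨f, hf, hfS⟩ := D.jordan S hα g2 g4
    have two : ∀ a b c : ZMod 2, a + b = c → a = b + c := by decide
    have two' : ∀ a b : ZMod 2, a + b + b = a := by decide
    have step : ∀ w, f (D.σ w) = f w + S (D.σ w) := fun w => by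
      rw [← hf _ _ (D.reg_corner w)]
      exact two _ _ _ (hfS (D.σ w))
    have key : f (D.σ (D.σ x)) = f x := by
      rw [step, step, hB, two']
    refine ⟨f, ?_, hfS⟩
    rintro y z (h | ⟨h, k⟩)
    · exact hf _ _ h
    · have e1 : f y = f x := h.elim (fun h => hf _ _ h) (fun h => (hf _ _ h).trans key)
      have e2 : f z = f x := k.elim (fun h => hf _ _ h) (fun h => (hf _ _ h).trans key)
      exact e1.trans e2.symm
  outer y := ∃ z, D.outer z ∧ glue D.reg x (D.σ (D.σ x)) z y
  outer_spec := by
    cases X with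
    | plane =>
      obtain ⟨w, hw⟩ : ∃ w, ∀ y, D.outer y ↔ D.reg w y := D.outer_spec
      refine ⟨w, fun y => ⟨?_, fun h => ⟨w, (hw w).2 (D.reg.refl w), h⟩⟩⟩
      rintro ⟨z, hz, hzy⟩
      exact (glue D.reg x (D.σ (D.σ x))).trans (Or.inl ((hw z).1 hz)) hzy
    | sphere =>
      have h : ∀ y, ¬ D.outer y := D.outer_spec
      rintro y ⟨z, hz, -⟩
      exact h z hz

/-- The corner at `x` is the corner of a monogon: an open disc region, not containing the point at
infinity, bounded by one edge that is a loop at one crossing. -/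
def IsMonogon {X : Ambient} (D : LinkDiagram X) (x : D.Dart) : Prop :=
  D.IsCrossing x ∧ D.α x = D.σ x ∧ (∀ y, D.reg x y → y = x) ∧ ¬ D.outer x

/-- The corners at `x` and `y` are the corners of a special bigon: a disc region, not containing
the point at infinity, bounded by two edges between two different crossings, one of the two edges
lying over the other one at both crossings. -/
def IsSpecialBigon {X : Ambient} (D : LinkDiagram X) (x y : D.Dart) : Prop :=
  D.IsCrossing x ∧ D.IsCrossing y ∧ ¬ D.σ.SameCycle x y ∧
  D.α x = D.σ y ∧ D.α y = D.σ x ∧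
  (∀ z, D.reg x z ↔ z = x ∨ z = y) ∧ ¬ D.outer x ∧
  D.isOver x = D.isOver (D.α x)

/-- The corners at `p`, `q`, `r` are the corners of a triangle to which a Reidemeister move III
applies: a disc region, not containing the point at infinity, bounded by three edges between three
different crossings, such that the strand of the edge from `p` to `q` is over both other strands or
under both other strands. -/
def IsSpecialTriangle {X : Ambient} (D : LinkDiagram X) (p q r : D.Dart) : Prop :=
  D.IsCrossing p ∧ D.IsCrossing q ∧ D.IsCrossing r ∧
  ¬ D.σ.SameCycle p q ∧ ¬ D.σ.SameCycle q r ∧ ¬ D.σ.SameCycle r p ∧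
  D.α p = D.σ q ∧ D.α q = D.σ r ∧ D.α r = D.σ p ∧
  (∀ z, D.reg p z ↔ z = p ∨ z = q ∨ z = r) ∧ ¬ D.outer p ∧
  D.isOver p = D.isOver (D.α p)

/-- The move `RI₋`. Replacing a kink by a simple arc is, up to isotopy, smoothing its crossing so
that the monogon is opened towards the opposite corner: the arc then runs through the old loop in
the reverse direction, without crossing itself. -/
def RI {X : Ambient} (D D' : LinkDiagram X) : Prop :=
  ∃ (E : LinkDiagram X) (x : E.Dart), Isotopic D E ∧ E.IsMonogon x ∧ Isotopic (E.smooth x) D'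

/-- The move `RII₋`. Pulling apart the two strands of a special bigon is, up to isotopy, smoothing
both crossings so that the bigon is opened towards both opposite corners: the strand that leaves
on the left then runs along the left edge of the bigon, and the other one along the right edge. -/
def RII {X : Ambient} (D D' : LinkDiagram X) : Prop :=
  ∃ (E : LinkDiagram X) (x y : E.Dart), Isotopic D E ∧ E.IsSpecialBigon x y ∧
    Isotopic ((E.smooth x).smooth y) D'

open Classical in
/-- For a triangle with corners `p`, `q`, `r`: along each of its three edges `t — α t`, exchange the
end of the edge at one crossing with the end of the strand that leaves the triangle at the other
crossing. This reverses the order in which each strand meets the other two. -/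
noncomputable def flipDart {X : Ambient} (D : LinkDiagram X) (p q r : D.Dart) :
    Equiv.Perm D.Dart :=
  let s := fun t => Equiv.swap (D.σ (D.σ t)) (D.α t) * Equiv.swap (D.σ (D.σ (D.α t))) t
  s p * s q * s r

open Classical in
/-- After a move III on the triangle with corners `p`, `q`, `r`, a dart has on its left the region
that was on the left of this dart. Outside the triangle nothing changes; each of the three edges of
the triangle has the new triangle on one side, and on the other side the region that met the old
triangle only in the opposite corner. -/
noncomputable def flipRegion {X : Ambient} (D : LinkDiagram X) (p q r : D.Dart) (z : D.Dart) :
    D.Dart :=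
  if z = p then D.σ (D.σ r)
  else if z = q then D.σ (D.σ p)
  else if z = r then D.σ (D.σ q)
  else if z = D.α p ∨ z = D.α q ∨ z = D.α r then p
  else z

/-- `D'` arises from `D` by a Reidemeister move III (of any kind) on a triangle. -/
def RIII {X : Ambient} (D D' : LinkDiagram X) : Prop :=
  ∃ (E E' : LinkDiagram X) (p q r : E.Dart) (e : E.Dart ≃ E'.Dart),
    Isotopic D E ∧ E.IsSpecialTriangle p q r ∧
    (∀ z, E'.α (e z) = e (E.α z)) ∧
    (∀ z, E'.σ (e z) = e (E.flipDart p q r (E.σ (E.flipDart p q r z)))) ∧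
    (∀ z, E.IsCrossing (E.flipDart p q r z) → E'.isOver (e z) = E.isOver (E.flipDart p q r z)) ∧
    (∀ y z, E'.reg (e y) (e z) ↔ E.reg (E.flipRegion p q r y) (E.flipRegion p q r z)) ∧
    (∀ z, E'.outer (e z) ↔ E.outer (E.flipRegion p q r z)) ∧
    Isotopic E' D'

/-- `D` and `D'` are diagrams of the same link: they are related by isotopies and Reidemeister
moves I, II, III in either direction. -/
def SameLink {X : Ambient} : LinkDiagram X → LinkDiagram X → Prop :=
  Relation.EqvGen (fun D D' => Isotopic D D' ∨ RI D D' ∨ RII D D' ∨ RIII D D')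

open Classical in
/-- The dart by which a strand leaves the vertex at which it arrives along the edge of `x`. -/
noncomputable def opposite {X : Ambient} (D : LinkDiagram X) (x : D.Dart) : D.Dart :=
  if D.IsCrossing x then D.σ (D.σ x) else D.σ x

/-- The darts on the link component through `x`. -/
def component {X : Ambient} (D : LinkDiagram X) (x : D.Dart) : Set D.Dart :=
  {y | Relation.EqvGen (fun a b => b = D.α a ∨ b = D.opposite a) x y}

/-- The link has an unknotted component that is split from the (nonempty) rest of the link: it has
a diagram in which some component has no crossing and is not the only component. -/
def HasSplitUnknotComponent {X : Ambient} (D : LinkDiagram X) : Prop :=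
  ∃ D' : LinkDiagram X, SameLink D D' ∧
    ∃ x, (∀ y ∈ D'.component x, ¬ D'.IsCrossing y) ∧ ∃ z, z ∉ D'.component x

/-- One move `RI₋` or `RII₋`. -/
def Reduces {X : Ambient} (D D' : LinkDiagram X) : Prop := RI D D' ∨ RII D D'

/-- No move `RI₋` or `RII₋` can be applied. -/
def IsMinimal {X : Ambient} (D : LinkDiagram X) : Prop := ∀ D', ¬ Reduces D D'

end LinkDiagram

namespace LinkDiagram

/-! The proof is Newman's lemma for a rewriting system with three kinds of step: forgetting a
bivalent point, opening a monogon, opening a special bigon. Forgetting points is made a step so that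
isotopy, which is generated by isomorphism and subdivision, is absorbed into the rewriting. Every
step lowers `size`, so it suffices to join any two steps `B`, `C` of one diagram `A`
(`Step.joinable`).

Steps at disjoint sets of vertices commute. The interesting cases share a crossing. Two monogons at
one crossing are equal or opposite, and opposite smoothings coincide. A monogon and a bigon at one
crossing lie in opposite corners; opening the monogon turns the bigon into a monogon, and opening
that gives the same result as opening the bigon. Two special bigons in opposite corners either have
the same two crossings, and then the smoothings agree, or merge, once the shared crossing is
smoothed, into a bigon that is not special. Of its two crossings either one may be kept: the
surviving crossing joins the same four outer ends with the same over/under information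
(`IsTwist.resolve_iso`).

Two special bigons in adjacent corners are the one obstruction: opening one of them leaves a circle
without crossings beside another component (`hasSplitUnknotComponent_of_adjacent`). Having a split
unknot component is defined through `SameLink`, so its absence passes from `D` to every diagram that
occurs.

Consequently joinability is transitive on these diagrams, and holds between `D₁` and `D₂`. A
simplification of a minimal diagram can only forget points or apply isomorphisms, so the common
simplification is isotopic to both. -/

variable {X : Ambient}

/-! ### Isomorphisms of diagrams -/

/-- The bijection of darts is an isomorphism of diagrams. -/
structure IsIso {A B : LinkDiagram X} (e : A.Dart ≃ B.Dart) : Prop where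
  α : ∀ x, B.α (e x) = e (A.α x)
  σ : ∀ x, B.σ (e x) = e (A.σ x)
  isOver : ∀ x, A.IsCrossing x → B.isOver (e x) = A.isOver x
  reg : ∀ x y, B.reg (e x) (e y) ↔ A.reg x y
  outer : ∀ x, B.outer (e x) ↔ A.outer x

theorem IsIso.iso {A B : LinkDiagram X} {e : A.Dart ≃ B.Dart} (h : IsIso e) : Iso A B :=
  ⟨e, h.α, h.σ, h.isOver, h.reg, h.outer⟩

theorem Iso.exists_isIso {A B : LinkDiagram X} (h : Iso A B) :
    ∃ e : A.Dart ≃ B.Dart, IsIso e :=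
  let ⟨e, h1, h2, h3, h4, h5⟩ := h
  ⟨e, h1, h2, h3, h4, h5⟩

theorem Iso.refl (A : LinkDiagram X) : Iso A A :=
  ⟨Equiv.refl _, fun _ => rfl, fun _ => rfl, fun _ _ => rfl, fun _ _ => Iff.rfl, fun _ => Iff.rfl⟩

theorem IsIso.isCrossing_iff {A B : LinkDiagram X} {e : A.Dart ≃ B.Dart} (h : IsIso e)
    (x : A.Dart) : B.IsCrossing (e x) ↔ A.IsCrossing x := by
  simp [IsCrossing, h.σ]

theorem Iso.symm {A B : LinkDiagram X} (h : Iso A B) : Iso B A := by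
  obtain ⟨e, h⟩ := h.exists_isIso
  refine ⟨e.symm, fun x => ?_, fun x => ?_, fun x hx => ?_, fun x y => ?_, fun x => ?_⟩
  · rw [Equiv.eq_symm_apply, ← h.α, e.apply_symm_apply]
  · rw [Equiv.eq_symm_apply, ← h.σ, e.apply_symm_apply]
  · rw [← h.isOver, e.apply_symm_apply]
    rwa [← h.isCrossing_iff, e.apply_symm_apply]
  · rw [← h.reg, e.apply_symm_apply, e.apply_symm_apply]
  · rw [← h.outer, e.apply_symm_apply]

theorem Iso.trans {A B C : LinkDiagram X} (h : Iso A B) (h' : Iso B C) : Iso A C := by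
  obtain ⟨e, h⟩ := h.exists_isIso
  obtain ⟨e', h'⟩ := h'.exists_isIso
  refine ⟨e.trans e', fun x => ?_, fun x => ?_, fun x hx => ?_, fun x y => ?_, fun x => ?_⟩
  · simp [h.α, h'.α]
  · simp [h.σ, h'.σ]
  · rw [← h.isOver x hx, ← h'.isOver _ ((h.isCrossing_iff x).2 hx)]; rfl
  · simp [h.reg, h'.reg]
  · simp [h.outer, h'.outer]

/-! ### Forgetting bivalent points -/

/-- A bivalent point that is not the only vertex on its closed curve. -/
def Removable (A : LinkDiagram X) (u : A.Dart) : Prop := A.σ (A.σ u) = u ∧ A.α u ≠ A.σ u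

open Classical in
/-- The other end of the edge of `z` once the bivalent point at `u` has been forgotten. -/
noncomputable def bypass (A : LinkDiagram X) (u z : A.Dart) : A.Dart :=
  if A.α z = u then A.α (A.σ u) else if A.α z = A.σ u then A.α u else A.α z

open Classical in
/-- A dart beside the same region as `z` that does not belong to the bivalent point at `u`. -/
noncomputable def shift (A : LinkDiagram X) (u z : A.Dart) : A.Dart :=
  if z = u then A.α (A.σ u) else if z = A.σ u then A.α u else z

theorem shift_reg (A : LinkDiagram X) {u : A.Dart} (h : A.Removable u) (z : A.Dart) :
    A.reg (A.shift u z) z := by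
  have h1 := A.reg_corner u
  have h2 := A.reg_corner (A.σ u)
  rw [h.1] at h2
  unfold shift
  split_ifs with e1 e2
  · rwa [e1]
  · rwa [e2]
  · exact A.reg.refl z

theorem shift_ne (A : LinkDiagram X) {u : A.Dart} (h : A.Removable u) (z : A.Dart) :
    A.shift u z ≠ u ∧ A.shift u z ≠ A.σ u := by
  have h1 := h.1
  have h2 := h.2
  have a1 := A.α_α
  have a2 := A.α_ne
  have a3 := A.σ_ne
  unfold shift
  grind

theorem bypass_ne (A : LinkDiagram X) {u : A.Dart} (h : A.Removable u) {z : A.Dart}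
    (hz : z ≠ u ∧ z ≠ A.σ u) : A.bypass u z ≠ u ∧ A.bypass u z ≠ A.σ u := by
  have h1 := h.1
  have h2 := h.2
  have a1 := A.α_α
  have a2 := A.α_ne
  have a3 := A.σ_ne
  unfold bypass
  grind

theorem bypass_bypass (A : LinkDiagram X) {u : A.Dart} (h : A.Removable u) {z : A.Dart}
    (hz : z ≠ u ∧ z ≠ A.σ u) : A.bypass u (A.bypass u z) = z := by
  have h1 := h.1
  have h2 := h.2
  have a1 := A.α_α
  have a2 := A.α_ne
  have a3 := A.σ_ne
  unfold bypass
  grind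

theorem bypass_self_ne (A : LinkDiagram X) {u : A.Dart} (h : A.Removable u) (z : A.Dart) :
    A.bypass u z ≠ z := by
  have h1 := h.1
  have h2 := h.2
  have a1 := A.α_α
  have a2 := A.α_ne
  have a3 := A.σ_ne
  unfold bypass
  grind

/-- This lets `shift` carry paths and cycles between `A` and the diagram without the point at `u`:
crossing an old edge becomes crossing a new one. -/
theorem shift_α (A : LinkDiagram X) {u : A.Dart} (h : A.Removable u) (z : A.Dart) :
    A.shift u (A.α z) = A.bypass u (A.shift u z) := by
  have h1 := h.1
  have h2 := h.2
  have a1 := A.α_α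
  have a2 := A.α_ne
  have a3 := A.σ_ne
  unfold bypass shift
  grind

theorem bypass_reg (A : LinkDiagram X) {u : A.Dart} (h : A.Removable u) (z : A.Dart) :
    A.reg (A.bypass u z) (A.α z) :=
  A.shift_reg h (A.α z)

theorem σ_avoid (A : LinkDiagram X) {u : A.Dart} (h : A.Removable u) (z : A.Dart) :
    (z ≠ u ∧ z ≠ A.σ u) ↔ (A.σ z ≠ u ∧ A.σ z ≠ A.σ u) := by
  have h1 := h.1
  have inj : ∀ a b, A.σ a = A.σ b → a = b := fun a b h => A.σ.injective h
  grind

theorem shift_of_ne (A : LinkDiagram X) {u z : A.Dart} (hz : z ≠ u ∧ z ≠ A.σ u) :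
    A.shift u z = z := by
  rw [shift, if_neg hz.1, if_neg hz.2]

/-- The diagram without the bivalent point at `u`. -/
noncomputable def delete (A : LinkDiagram X) (u : A.Dart) (h : A.Removable u) :
    LinkDiagram X where
  Dart := {z : A.Dart // z ≠ u ∧ z ≠ A.σ u}
  finite := have := A.finite; inferInstance
  nonempty := A.nonempty.map fun z => ⟨A.shift u z, A.shift_ne h z⟩
  α := Function.Involutive.toPerm
    (fun z : {z : A.Dart // z ≠ u ∧ z ≠ A.σ u} => ⟨A.bypass u z, A.bypass_ne h z.2⟩)
    (fun z => Subtype.ext (A.bypass_bypass h z.2))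
  α_α z := Subtype.ext (A.bypass_bypass h z.2)
  α_ne z hz := A.bypass_self_ne h z (congrArg Subtype.val hz)
  σ := A.σ.subtypePerm fun z => (A.σ_avoid h z).symm
  σ_ne z hz := A.σ_ne z (congrArg Subtype.val hz)
  σ_four z := Subtype.ext (A.σ_four z)
  isOver z := A.isOver z
  isOver_σ z hz := A.isOver_σ z fun h0 => hz (Subtype.ext h0)
  reg := A.reg.comap Subtype.val
  reg_corner z := A.reg.trans (A.bypass_reg h _) (A.reg_corner z)
  connected y z := by
    -- A path between regions of `A` is pushed off the point at `u` dart by dart with `shift`, which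
    -- fixes the given end points.
    have key : ∀ a b, Relation.EqvGen (fun a b => b = A.α a ∨ A.reg a b) a b →
        Relation.EqvGen (fun a b : {z : A.Dart // z ≠ u ∧ z ≠ A.σ u} =>
          b = ⟨A.bypass u a, A.bypass_ne h a.2⟩ ∨ A.reg a b)
          ⟨A.shift u a, A.shift_ne h a⟩ ⟨A.shift u b, A.shift_ne h b⟩ := by
      intro a b hab
      induction hab with
      | rel a b hab =>
        refine .rel _ _ (hab.imp (fun e => Subtype.ext ?_) fun e => ?_)
        · rw [e]
          exact A.shift_α h a
        · exact A.reg.trans (A.shift_reg h a) (A.reg.trans e (A.reg.symm (A.shift_reg h b)))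
      | refl a => exact .refl _
      | symm a b _ ih => exact .symm _ _ ih
      | trans a b c _ _ ih ih' => exact .trans _ _ _ ih ih'
    have := key y z (A.connected y z)
    simp only [A.shift_of_ne y.2, A.shift_of_ne z.2] at this
    exact this
  jordan S hα h2 h4 := by
    have two : ∀ a : ZMod 2, a + a = 0 := by decide
    -- The cycle is extended to `A` by evaluating it at shifted darts. Both darts at `u` then carry
    -- the value of the merged edge (`hu` below), so the extension is even at the forgotten point.
    have hS : ∀ z, S ⟨A.shift u (A.α z), A.shift_ne h _⟩ = S ⟨A.shift u z, A.shift_ne h z⟩ := by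
      intro z
      rw [← hα ⟨A.shift u z, A.shift_ne h z⟩]
      exact congrArg S (Subtype.ext (A.shift_α h z))
    have hne : ∀ z (hz : z ≠ u ∧ z ≠ A.σ u),
        S ⟨A.shift u z, A.shift_ne h z⟩ = S ⟨z, hz⟩ := fun z hz =>
      congrArg S (Subtype.ext (A.shift_of_ne hz))
    have hu : S ⟨A.shift u u, A.shift_ne h u⟩ = S ⟨A.shift u (A.σ u), A.shift_ne h _⟩ := by
      rw [← hα ⟨A.shift u u, A.shift_ne h u⟩]
      refine congrArg S (Subtype.ext ?_)
      have h1 := h.1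
      have h2 := h.2
      have a1 := A.α_α
      have a3 := A.σ_ne
      change A.bypass u (A.shift u u) = _
      unfold bypass shift
      grind
    obtain ⟨f, hf, hfS⟩ := A.jordan (fun z => S ⟨A.shift u z, A.shift_ne h z⟩) hS
      (fun z hz => by
        by_cases hzu : z ≠ u ∧ z ≠ A.σ u
        · simp only [hne z hzu, hne _ ((A.σ_avoid h z).1 hzu)]
          exact h2 ⟨z, hzu⟩ (Subtype.ext hz)
        · obtain rfl | rfl : z = u ∨ z = A.σ u := by tauto
          · simp only [← hu, two]
          · simp only [h.1, ← hu, two])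
      (fun z hz => by
        have hzu : z ≠ u ∧ z ≠ A.σ u :=
          ⟨fun e => hz (e ▸ h.1), fun e => hz (by rw [e, h.1])⟩
        have h1 := (A.σ_avoid h z).1 hzu
        have h2 := (A.σ_avoid h _).1 h1
        have h3 := (A.σ_avoid h _).1 h2
        simp only [hne z hzu, hne _ h1, hne _ h2, hne _ h3]
        exact h4 ⟨z, hzu⟩ fun e => hz (congrArg Subtype.val e))
    refine ⟨fun z => f z, fun x y hxy => hf _ _ hxy, fun z => ?_⟩
    have := hfS z
    rw [hne z z.2, ← hf _ _ (A.bypass_reg h z)] at this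
    exact this
  outer z := A.outer z
  outer_spec := by
    cases X with
    | plane =>
      obtain ⟨w, hw⟩ : ∃ w, ∀ y, A.outer y ↔ A.reg w y := A.outer_spec
      refine ⟨⟨A.shift u w, A.shift_ne h w⟩, fun y => (hw y).trans ?_⟩
      exact ⟨fun e => A.reg.trans (A.shift_reg h w) e,
        fun e => A.reg.trans (A.reg.symm (A.shift_reg h w)) e⟩
    | sphere => exact fun y => A.outer_spec y

theorem subdivides_delete (A : LinkDiagram X) {u : A.Dart} (h : A.Removable u) :
    Subdivides (A.delete u h) A := by
  have h1 := h.1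
  have h2 := h.2
  have a1 := A.α_α
  have a2 := A.α_ne
  have a3 := A.σ_ne
  have hu : A.α u ≠ u ∧ A.α u ≠ A.σ u := ⟨a2 u, h2⟩
  have hb : A.bypass u (A.α u) = A.α (A.σ u) := by rw [bypass, if_pos (a1 u)]
  refine ⟨⟨A.α u, hu⟩, u, A.σ u, Subtype.val, Subtype.val_injective, (a3 u).symm, ?_, rfl, h1,
    fun z => rfl, a1 u, ?_, fun z hz hz' => ?_, fun _ _ => rfl, fun _ _ => Iff.rfl,
    fun _ => Iff.rfl⟩
  · ext z
    exact ⟨fun ⟨w, hw⟩ => by simpa [← hw] using w.2, fun hz => ⟨⟨z, by simpa using hz⟩, rfl⟩⟩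
  · change A.α (A.bypass u (A.α u)) = _
    rw [hb, a1]
  · have hz1 : z.1 ≠ A.α u := fun e => hz (Subtype.ext e)
    have hz2 : z.1 ≠ A.α (A.σ u) := fun e => hz' (Subtype.ext (e.trans hb.symm))
    change A.α z.1 = A.bypass u z.1
    unfold bypass
    grind

/-- Every generator of isotopy is thereby an isomorphism or the inverse of a step. The added point
is removable because the edge of `u` leads to an old dart and not to `v`. -/
theorem Subdivides.exists_delete {A B : LinkDiagram X} (h : Subdivides B A) :
    ∃ (u : A.Dart) (hu : A.Removable u), Iso (A.delete u hu) B := by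
  obtain ⟨x, u, v, i, hi, huv, hr, hu, hv, hσ, hx, hx', hα, ho, hreg, hout⟩ := h
  have a1 := A.α_α
  have b1 := B.α_α
  have b2 := B.α_ne
  have hne : ∀ z, i z ≠ u ∧ i z ≠ v := fun z => by
    have : i z ∈ ({u, v} : Set A.Dart)ᶜ := hr ▸ Set.mem_range_self z
    simpa using this
  have hrem : A.Removable u := ⟨by rw [hu, hv], by rw [hu, ← hx, a1]; exact (hne x).2⟩
  refine ⟨u, hrem, Iso.symm ?_⟩
  let j : B.Dart → {z : A.Dart // z ≠ u ∧ z ≠ A.σ u} := fun z => ⟨i z, by rw [hu]; exact hne z⟩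
  have hj : Function.Bijective j := by
    refine ⟨fun a b hab => hi (congrArg Subtype.val hab), fun ⟨z, hz⟩ => ?_⟩
    have : z ∈ Set.range i := by
      rw [hr]
      rw [hu] at hz
      simpa using hz
    obtain ⟨w, hw⟩ := this
    exact ⟨w, Subtype.ext hw⟩
  refine ⟨Equiv.ofBijective j hj, fun z => Subtype.ext ?_, fun z => Subtype.ext (hσ z), ho, hreg,
    hout⟩
  change A.bypass u (i z) = i (B.α z)
  unfold bypass
  rw [hu]
  by_cases e : z = x
  · subst e
    rw [if_pos hx, ← hx', a1]
  · by_cases e' : z = B.α x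
    · subst e'
      rw [if_neg (by rw [hx']; exact huv.symm), if_pos hx', b1, ← hx, a1]
    · rw [hα z e e', if_neg (hne _).1, if_neg (hne _).2]

theorem Iso.isotopic {A B : LinkDiagram X} (h : Iso A B) : Isotopic A B := .rel _ _ (.inl h)

theorem isotopic_delete (A : LinkDiagram X) {u : A.Dart} (h : A.Removable u) :
    Isotopic A (A.delete u h) := .symm _ _ (.rel _ _ (.inr (A.subdivides_delete h)))

/-! ### Smoothing: regions, vertices, isomorphism invariance -/

/-- Minimality of `glue` among the equivalence relations that contain `r` and identify `a` with `b`;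
its symmetry and commutation rules follow formally from this. -/
theorem glue_le {T : Type} {r s : Setoid T} {a b : T} (h : ∀ y z, r y z → s y z) (hab : s a b)
    {y z : T} (hyz : glue r a b y z) : s y z := by
  rcases hyz with h1 | ⟨h1, h2⟩
  · exact h _ _ h1
  · have e1 : s y a := h1.elim (h _ _) fun k => s.trans (h _ _ k) (s.symm hab)
    have e2 : s z a := h2.elim (h _ _) fun k => s.trans (h _ _ k) (s.symm hab)
    exact s.trans e1 (s.symm e2)

theorem glue_mk {T : Type} (r : Setoid T) (a b : T) : glue r a b a b :=
  .inr ⟨.inl (r.refl a), .inr (r.refl b)⟩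

theorem glue_comm {T : Type} (r : Setoid T) (a b c d : T) {y z : T}
    (h : glue (glue r a b) c d y z) : glue (glue r c d) a b y z :=
  glue_le (fun _ _ h => glue_le (fun _ _ h => Or.inl (Or.inl h)) (glue_mk _ a b) h)
    (.inl (glue_mk r c d)) h

theorem glue_swap {T : Type} (r : Setoid T) (a b : T) {y z : T}
    (h : glue r a b y z) : glue r b a y z :=
  glue_le (fun _ _ h => Or.inl h) ((glue r b a).symm (glue_mk r b a)) h

open Classical in
theorem smooth_σ (A : LinkDiagram X) (x z : A.Dart) : (A.smooth x).σ z =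
    if z = x then A.σ (A.σ (A.σ x)) else if z = A.σ (A.σ x) then A.σ x else A.σ z :=
  smooth_apply A.σ x z

theorem isCrossing_of_smooth {A : LinkDiagram X} {x z : A.Dart}
    (h : (A.smooth x).IsCrossing z) : A.IsCrossing z := by
  have h4 := A.σ_four
  have inj : ∀ a b, A.σ a = A.σ b → a = b := fun a b h => A.σ.injective h
  unfold IsCrossing at *
  rw [smooth_σ, smooth_σ] at h
  grind

/-- `y` is a dart at the vertex of `x`. -/
def AtVertex (A : LinkDiagram X) (x y : A.Dart) : Prop :=
  y = x ∨ y = A.σ x ∨ y = A.σ (A.σ x) ∨ y = A.σ (A.σ (A.σ x))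

/-- Since `σ` has order dividing four, exponents reduce modulo 4. The explicit disjunction makes
finite case analysis at a vertex possible. -/
theorem sameCycle_iff (A : LinkDiagram X) (x y : A.Dart) :
    A.σ.SameCycle x y ↔ A.AtVertex x y := by
  constructor
  · rintro ⟨n, rfl⟩
    have h4 : A.σ ^ (4 : ℤ) = 1 := by
      ext z
      exact A.σ_four z
    have : A.σ ^ n = A.σ ^ (n % 4) := by
      conv_lhs => rw [← Int.emod_add_mul_ediv n 4, zpow_add, zpow_mul, h4, one_zpow, mul_one]
    rw [this]
    have h0 := Int.emod_nonneg n (by norm_num : (4 : ℤ) ≠ 0)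
    have h1 := Int.emod_lt_of_pos n (by norm_num : (0 : ℤ) < 4)
    generalize n % 4 = m at h0 h1
    interval_cases m
    · exact .inl rfl
    · exact .inr (.inl rfl)
    · exact .inr (.inr (.inl rfl))
    · exact .inr (.inr (.inr rfl))
  · rintro (h | h | h | h)
    · exact ⟨0, h.symm⟩
    · exact ⟨1, h.symm⟩
    · exact ⟨2, h.symm⟩
    · exact ⟨3, h.symm⟩

section
variable {A B : LinkDiagram X} {e : A.Dart ≃ B.Dart}

theorem IsIso.smooth (h : IsIso e) (x : A.Dart) :
    IsIso (A := A.smooth x) (B := B.smooth (e x)) e := by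
  have hreg : ∀ y z, (B.smooth (e x)).reg (e y) (e z) ↔ (A.smooth x).reg y z := by
    intro y z
    change (_ ∨ _) ↔ (_ ∨ _)
    simp only [h.σ, h.reg]
  have hσ : ∀ z : A.Dart, (B.smooth (e x)).σ (e z) = e ((A.smooth x).σ z) := by
    intro z
    have inj : ∀ a b, e a = e b → a = b := fun a b h => e.injective h
    have hσ := h.σ
    rw [smooth_σ, smooth_σ]
    grind
  refine ⟨h.α, hσ, fun z hz => h.isOver z (isCrossing_of_smooth hz), hreg, fun z => ?_⟩
  constructor
  · rintro ⟨w, hw, k⟩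
    refine ⟨e.symm w, by rwa [← h.outer, e.apply_symm_apply], ?_⟩
    refine (hreg _ _).1 ?_
    rwa [e.apply_symm_apply]
  · rintro ⟨w, hw, k⟩
    exact ⟨e w, (h.outer w).2 hw, (hreg _ _).2 k⟩

theorem IsIso.removable (h : IsIso e) {u : A.Dart} (hu : A.Removable u) : B.Removable (e u) := by
  simpa [Removable, h.α, h.σ] using hu

theorem IsIso.delete_iso (h : IsIso e) {u : A.Dart} (hu : A.Removable u) :
    Iso (A.delete u hu) (B.delete (e u) (h.removable hu)) := by
  refine ⟨e.subtypeEquiv fun z => ?_, fun z => Subtype.ext ?_, fun z => Subtype.ext (h.σ z.1),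
    fun z hz => h.isOver z.1 fun h0 => hz (Subtype.ext h0), fun y z => h.reg y.1 z.1,
    fun z => h.outer z.1⟩
  · simp [h.σ]
  · have inj : ∀ a b, e a = e b → a = b := fun a b h => e.injective h
    have hσ := h.σ
    have hα := h.α
    change B.bypass (e u) (e z.1) = e (A.bypass u z.1)
    unfold bypass
    grind

theorem IsIso.isMonogon (h : IsIso e) {x : A.Dart} (hx : A.IsMonogon x) : B.IsMonogon (e x) := by
  obtain ⟨h1, h2, h3, h4⟩ := hx
  refine ⟨(h.isCrossing_iff x).2 h1, by rw [h.α, h.σ, h2], fun y hy => ?_, by rwa [h.outer]⟩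
  obtain ⟨z, rfl⟩ := e.surjective y
  rw [h3 z ((h.reg _ _).1 hy)]

theorem IsIso.isSpecialBigon (h : IsIso e) {x y : A.Dart} (hxy : A.IsSpecialBigon x y) :
    B.IsSpecialBigon (e x) (e y) := by
  obtain ⟨h1, h2, h3, h4, h5, h6, h7, h8⟩ := hxy
  refine ⟨(h.isCrossing_iff x).2 h1, (h.isCrossing_iff y).2 h2, ?_, by rw [h.α, h.σ, h4],
    by rw [h.α, h.σ, h5], fun z => ?_, by rwa [h.outer], ?_⟩
  · rw [sameCycle_iff] at *
    simpa [AtVertex, h.σ] using h3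
  · obtain ⟨z, rfl⟩ := e.surjective z
    rw [h.reg, h6, e.apply_eq_iff_eq, e.apply_eq_iff_eq]
  · rw [h.α, h.isOver x h1, h.isOver, h8]
    intro h0
    rw [h4] at h0
    exact h2 (A.σ.injective h0)

end

/-! ### Simplification steps, termination, Newman's lemma -/

/-- One simplification: a bivalent point is forgotten, a monogon is opened or a special bigon is
opened. -/
def Step (A B : LinkDiagram X) : Prop :=
  (∃ (u : A.Dart) (h : A.Removable u), Iso (A.delete u h) B) ∨
  (∃ x, A.IsMonogon x ∧ Iso (A.smooth x) B) ∨
  ∃ x y, A.IsSpecialBigon x y ∧ Iso ((A.smooth x).smooth y) B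

theorem Step.of_iso {A A' B : LinkDiagram X} (h : Step A B) (hi : Iso A A') : Step A' B := by
  obtain ⟨e, he⟩ := hi.exists_isIso
  rcases h with ⟨u, h, k⟩ | ⟨x, h, k⟩ | ⟨x, y, h, k⟩
  · exact .inl ⟨e u, he.removable h, (he.delete_iso h).symm.trans k⟩
  · exact .inr (.inl ⟨e x, he.isMonogon h, (he.smooth x).iso.symm.trans k⟩)
  · exact .inr (.inr ⟨e x, e y, he.isSpecialBigon h, ((he.smooth x).smooth y).iso.symm.trans k⟩)

/-- Finitely many simplifications and isomorphisms. -/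
def Simplifies : LinkDiagram X → LinkDiagram X → Prop :=
  Relation.ReflTransGen fun A B => Step A B ∨ Iso A B

/-- The diagrams have a common simplification. -/
def Joinable (A B : LinkDiagram X) : Prop := ∃ C, Simplifies A C ∧ Simplifies B C

theorem Iso.simplifies {A B : LinkDiagram X} (h : Iso A B) : Simplifies A B := .single (.inr h)

theorem Step.simplifies {A B : LinkDiagram X} (h : Step A B) : Simplifies A B := .single (.inl h)

theorem simplifies_delete (A : LinkDiagram X) {u : A.Dart} (h : A.Removable u) :
    Simplifies A (A.delete u h) := .single (.inl (.inl ⟨u, h, .refl _⟩))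

theorem IsMonogon.simplifies {A : LinkDiagram X} {x : A.Dart} (h : A.IsMonogon x) :
    Simplifies A (A.smooth x) := .single (.inl (.inr (.inl ⟨x, h, .refl _⟩)))

theorem IsSpecialBigon.simplifies {A : LinkDiagram X} {x y : A.Dart} (h : A.IsSpecialBigon x y) :
    Simplifies A ((A.smooth x).smooth y) := .single (.inl (.inr (.inr ⟨x, y, h, .refl _⟩)))

theorem Joinable.symm {A B : LinkDiagram X} : Joinable A B → Joinable B A :=
  fun ⟨C, h, h'⟩ => ⟨C, h', h⟩

theorem Joinable.of_simplifies {A B A' B' : LinkDiagram X} (h : Joinable A' B')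
    (hA : Simplifies A A') (hB : Simplifies B B') : Joinable A B :=
  let ⟨C, h1, h2⟩ := h
  ⟨C, hA.trans h1, hB.trans h2⟩

theorem Simplifies.joinable {A B : LinkDiagram X} (h : Simplifies A B) : Joinable A B :=
  ⟨B, h, .refl⟩

theorem Iso.joinable {A B : LinkDiagram X} (h : Iso A B) : Joinable A B := h.simplifies.joinable

/-- Isomorphisms that precede the first step are absorbed into it, so a simplification that is not
an isomorphism begins with a drop in `size`. -/
theorem Simplifies.eq_or_step {A B : LinkDiagram X} (h : Simplifies A B) :
    Iso A B ∨ ∃ C, Step A C ∧ Simplifies C B := by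
  induction h using Relation.ReflTransGen.head_induction_on with
  | refl => exact .inl (.refl _)
  | head h h' ih =>
    rcases h with h | h
    · exact .inr ⟨_, h, h'⟩
    · rcases ih with ih | ⟨C, h1, h2⟩
      · exact .inl (h.trans ih)
      · exact .inr ⟨C, h1.of_iso h.symm, h2⟩

/-- The number of darts plus the number of darts at crossings. -/
noncomputable def size (A : LinkDiagram X) : ℕ := Nat.card A.Dart + Nat.card {x // A.IsCrossing x}

theorem Iso.size_eq {A B : LinkDiagram X} (h : Iso A B) : A.size = B.size := by
  obtain ⟨e, h⟩ := h.exists_isIso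
  unfold size
  rw [Nat.card_congr e, Nat.card_congr (e.subtypeEquiv fun x => (h.isCrossing_iff x).symm)]

theorem size_delete_lt (A : LinkDiagram X) {u : A.Dart} (h : A.Removable u) :
    (A.delete u h).size < A.size := by
  have := A.finite
  refine add_lt_add_of_lt_of_le ?_ ?_
  · exact Finite.card_subtype_lt (p := fun z => z ≠ u ∧ z ≠ A.σ u) (x := u) fun h => h.1 rfl
  · refine Nat.card_le_card_of_injective
      (fun z : {z // (A.delete u h).IsCrossing z} => (⟨z.1.1, fun h0 => z.2 (Subtype.ext h0)⟩ :
        {z // A.IsCrossing z})) fun a b hab => ?_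
    exact Subtype.ext (Subtype.ext (congrArg (fun t => t.1) hab))

theorem not_isCrossing_smooth (A : LinkDiagram X) (x : A.Dart) :
    ¬ (A.smooth x).IsCrossing x := by
  have h4 := A.σ_four
  have inj : ∀ a b, A.σ a = A.σ b → a = b := fun a b h => A.σ.injective h
  unfold IsCrossing
  rw [smooth_σ, smooth_σ]
  grind

theorem size_smooth_le (A : LinkDiagram X) (x : A.Dart) : (A.smooth x).size ≤ A.size := by
  have := A.finite
  refine Nat.add_le_add_left (Nat.card_le_card_of_injective
    (fun z : {z // (A.smooth x).IsCrossing z} => (⟨z.1, isCrossing_of_smooth z.2⟩ :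
      {z // A.IsCrossing z})) fun a b hab => ?_) _
  exact Subtype.ext (congrArg (fun t => t.1) hab)

theorem size_smooth_lt (A : LinkDiagram X) {x : A.Dart} (h : A.IsCrossing x) :
    (A.smooth x).size < A.size := by
  have := A.finite
  refine Nat.add_lt_add_left ?_ _
  have := Finite.card_subtype_lt (α := {z // A.IsCrossing z})
    (p := fun z => (A.smooth x).IsCrossing z.1) (x := ⟨x, h⟩) (A.not_isCrossing_smooth x)
  refine lt_of_le_of_lt (Nat.card_le_card_of_injective
    (fun z : {z // (A.smooth x).IsCrossing z} => (⟨⟨z.1, isCrossing_of_smooth z.2⟩, z.2⟩ :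
      {z : {z // A.IsCrossing z} // (A.smooth x).IsCrossing z.1})) fun a b hab => ?_) this
  exact Subtype.ext (congrArg (fun t => t.1.1) hab)

/-- Forgetting a point removes darts and creates no crossing; smoothing keeps the darts but turns a
crossing into bivalent points. Hence the sum of the two counts decreases in all cases. -/
theorem Step.size_lt {A B : LinkDiagram X} (h : Step A B) : B.size < A.size := by
  rcases h with ⟨u, h, k⟩ | ⟨x, h, k⟩ | ⟨x, y, h, k⟩
  · exact k.size_eq ▸ A.size_delete_lt h
  · exact k.size_eq ▸ A.size_smooth_lt h.1
  · exact k.size_eq ▸ ((A.smooth x).size_smooth_le y).trans_lt (A.size_smooth_lt h.1)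

theorem Step.sameLink {A B : LinkDiagram X} (h : Step A B) : SameLink A B := by
  rcases h with ⟨u, h, k⟩ | ⟨x, h, k⟩ | ⟨x, y, h, k⟩
  · exact .rel _ _ (.inl (.trans _ _ _ (A.isotopic_delete h) k.isotopic))
  · exact .rel _ _ (.inr (.inl ⟨A, x, .refl _, h, k.isotopic⟩))
  · exact .rel _ _ (.inr (.inr (.inl ⟨A, x, y, .refl _, h, k.isotopic⟩)))

theorem Simplifies.sameLink {A B : LinkDiagram X} (h : Simplifies A B) : SameLink A B := by
  induction h with
  | refl => exact .refl _
  | tail _ h ih =>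
    exact .trans _ _ _ ih (h.elim Step.sameLink fun h => .rel _ _ (.inl h.isotopic))

theorem SameLink.hasSplitUnknotComponent {A B : LinkDiagram X} (h : SameLink A B)
    (hB : B.HasSplitUnknotComponent) : A.HasSplitUnknotComponent := by
  obtain ⟨C, hC, hx⟩ := hB
  exact ⟨C, .trans _ _ _ h hC, hx⟩

/-- Newman's lemma. -/
theorem confluent_of_locally_confluent
    (hl : ∀ A B C : LinkDiagram X, ¬ A.HasSplitUnknotComponent → Step A B → Step A C →
      Joinable B C) (A B C : LinkDiagram X) (hA : ¬ A.HasSplitUnknotComponent)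
    (hB : Simplifies A B) (hC : Simplifies A C) : Joinable B C := by
  induction hn : A.size using Nat.strong_induction_on generalizing A B C with
  | _ n ih =>
    subst hn
    rcases hB.eq_or_step with hB | ⟨B₁, hB₁, hB⟩
    · exact ⟨C, hB.symm.simplifies.trans hC, .refl⟩
    rcases hC.eq_or_step with hC | ⟨C₁, hC₁, hC⟩
    · exact ⟨B, .refl, hC.symm.simplifies.trans (hB₁.simplifies.trans hB)⟩
    -- The usual diamond: `M` joins the first steps, `N` joins `B` with `M` below `B₁`, and `P`
    -- joins `N` with `C` below `C₁`.
    obtain ⟨M, hM, hM'⟩ := hl A B₁ C₁ hA hB₁ hC₁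
    obtain ⟨N, hN, hN'⟩ := ih _ hB₁.size_lt B₁ B M
      (fun h => hA (hB₁.sameLink.hasSplitUnknotComponent h)) hB hM rfl
    obtain ⟨P, hP, hP'⟩ := ih _ hC₁.size_lt C₁ N C
      (fun h => hA (hC₁.sameLink.hasSplitUnknotComponent h)) (hM'.trans hN') hC rfl
    exact ⟨P, hN.trans hP, hP'⟩

/-! ### Smoothings at different crossings -/

theorem outer_iff_of_reg (A : LinkDiagram X) {x y : A.Dart} (h : A.reg x y) :
    A.outer x ↔ A.outer y := by
  cases X with
  | plane =>
    obtain ⟨w, hw⟩ : ∃ w, ∀ y, A.outer y ↔ A.reg w y := A.outer_spec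
    rw [hw, hw]
    exact ⟨fun k => A.reg.trans k h, fun k => A.reg.trans k (A.reg.symm h)⟩
  | sphere => exact iff_of_false (A.outer_spec x) (A.outer_spec y)

/-- A channel between two opposite corners is the same from either end. -/
theorem smooth_opposite (A : LinkDiagram X) (x : A.Dart) :
    IsIso (A := A.smooth (A.σ (A.σ x))) (B := A.smooth x) (Equiv.refl A.Dart) := by
  have h4 := A.σ_four
  have hreg : ∀ y z, (A.smooth (A.σ (A.σ x))).reg y z ↔ (A.smooth x).reg y z := by
    intro y z
    change glue A.reg _ _ y z ↔ glue A.reg _ _ y z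
    rw [h4]
    exact ⟨glue_swap _ _ _, glue_swap _ _ _⟩
  have hσ : ∀ z : A.Dart, (A.smooth x).σ z = (A.smooth (A.σ (A.σ x))).σ z := by
    intro z
    rw [smooth_σ, smooth_σ]
    grind
  refine ⟨fun _ => rfl, hσ, fun _ _ => rfl,
    fun y z => (hreg y z).symm, fun z => ?_⟩
  · exact ⟨fun ⟨w, hw, h⟩ => ⟨w, hw, (hreg _ _).2 h⟩, fun ⟨w, hw, h⟩ => ⟨w, hw, (hreg _ _).1 h⟩⟩

/-- The two nested existentials collapse, so comparing outer regions of double smoothings reduces to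
comparing `reg`. -/
theorem smooth_smooth_outer (A : LinkDiagram X) (x y z : A.Dart) :
    ((A.smooth x).smooth y).outer z ↔ ∃ w, A.outer w ∧ ((A.smooth x).smooth y).reg w z := by
  constructor
  · rintro ⟨w, ⟨v, hv, hvw⟩, hwz⟩
    exact ⟨v, hv, ((A.smooth x).smooth y).reg.trans (Or.inl hvw) hwz⟩
  · rintro ⟨w, hw, hwz⟩
    exact ⟨w, ⟨w, hw, (A.smooth x).reg.refl w⟩, hwz⟩

open Classical in
theorem smooth_smooth_σ (A : LinkDiagram X) {x y : A.Dart} (h : ¬ A.AtVertex x y) (z : A.Dart) :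
    ((A.smooth x).smooth y).σ z =
      if z = y then A.σ (A.σ (A.σ y)) else if z = A.σ (A.σ y) then A.σ y else
      if z = x then A.σ (A.σ (A.σ x)) else if z = A.σ (A.σ x) then A.σ x else A.σ z := by
  have h4 := A.σ_four
  have inj : ∀ a b, A.σ a = A.σ b → a = b := fun a b h => A.σ.injective h
  unfold AtVertex at h
  refine (smooth_apply (T := A.Dart) (A.σ * Equiv.swap x (A.σ (A.σ x))) y z).trans ?_
  simp only [smooth_apply]
  grind

/-- `smooth` at darts of different vertices commutes. -/
theorem smooth_smooth_comm (A : LinkDiagram X) {x y : A.Dart} (h : ¬ A.AtVertex x y) :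
    IsIso (A := (A.smooth x).smooth y) (B := (A.smooth y).smooth x) (Equiv.refl A.Dart) := by
  have h4 := A.σ_four
  have inj : ∀ a b, A.σ a = A.σ b → a = b := fun a b h => A.σ.injective h
  have h' : ¬ A.AtVertex y x := by
    unfold AtVertex at *
    grind
  have e1 : (A.smooth x).σ ((A.smooth x).σ y) = A.σ (A.σ y) := by
    unfold AtVertex at h
    rw [smooth_σ, smooth_σ]
    grind
  have e2 : (A.smooth y).σ ((A.smooth y).σ x) = A.σ (A.σ x) := by
    unfold AtVertex at h
    rw [smooth_σ, smooth_σ]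
    grind
  have hreg : ∀ a b : A.Dart,
      ((A.smooth x).smooth y).reg a b ↔ ((A.smooth y).smooth x).reg a b := by
    intro a b
    change glue (glue A.reg _ _) _ _ a b ↔ glue (glue A.reg _ _) _ _ a b
    rw [e1, e2]
    exact ⟨glue_comm _ _ _ _ _, glue_comm _ _ _ _ _⟩
  have hσ : ∀ z : A.Dart, ((A.smooth y).smooth x).σ z = ((A.smooth x).smooth y).σ z := by
    intro z
    rw [smooth_smooth_σ A h, smooth_smooth_σ A h']
    unfold AtVertex at h
    grind
  have hout : ∀ z : A.Dart, ((A.smooth y).smooth x).outer z ↔ ((A.smooth x).smooth y).outer z := by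
    intro z
    rw [smooth_smooth_outer, smooth_smooth_outer]
    exact exists_congr fun w => and_congr_right fun _ => (hreg _ _).symm
  exact ⟨fun _ => rfl, hσ, fun _ _ => rfl, fun y z => (hreg y z).symm, hout⟩

/-- The over/under condition mentions only one edge; the other edge inherits it because over and
under alternate around each crossing. -/
theorem IsSpecialBigon.symm {A : LinkDiagram X} {x y : A.Dart} (h : A.IsSpecialBigon x y) :
    A.IsSpecialBigon y x := by
  obtain ⟨h1, h2, h3, h4, h5, h6, h7, h8⟩ := h
  have hxy : A.reg x y := (h6 y).2 (.inr rfl)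
  have ox := A.isOver_σ x h1
  have oy := A.isOver_σ y h2
  refine ⟨h2, h1, fun k => h3 k.symm, h5, h4, fun z => ?_,
    fun k => h7 ((A.outer_iff_of_reg hxy).2 k), ?_⟩
  · rw [or_comm, ← h6]
    exact ⟨A.reg.trans hxy, A.reg.trans (A.reg.symm hxy)⟩
  · rw [h5, ox, h8, h4, oy, Bool.not_not]

theorem isCrossing_smooth {A : LinkDiagram X} {x z : A.Dart} (hz : A.IsCrossing z)
    (h : ¬ A.AtVertex x z) : (A.smooth x).IsCrossing z := by
  have h4 := A.σ_four
  have inj : ∀ a b, A.σ a = A.σ b → a = b := fun a b h => A.σ.injective h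
  unfold IsCrossing AtVertex at *
  rw [smooth_σ, smooth_σ]
  grind

theorem smooth_σ_of_not_atVertex {A : LinkDiagram X} {x z : A.Dart} (h : ¬ A.AtVertex x z) :
    (A.smooth x).σ z = A.σ z := by
  unfold AtVertex at h
  rw [smooth_σ]
  grind

theorem AtVertex.of_smooth {A : LinkDiagram X} {x y z : A.Dart} (h : (A.smooth x).AtVertex y z) :
    A.AtVertex y z := by
  have h4 := A.σ_four
  have inj : ∀ a b, A.σ a = A.σ b → a = b := fun a b h => A.σ.injective h
  unfold AtVertex at *
  simp only [smooth_σ] at h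
  grind

theorem AtVertex.symm {A : LinkDiagram X} {x y : A.Dart} (h : A.AtVertex x y) :
    A.AtVertex y x := by
  rw [← sameCycle_iff] at *
  exact Equiv.Perm.SameCycle.symm h

theorem AtVertex.trans {A : LinkDiagram X} {x y z : A.Dart} (h : A.AtVertex x y)
    (h' : A.AtVertex y z) : A.AtVertex x z := by
  rw [← sameCycle_iff] at *
  exact Equiv.Perm.SameCycle.trans h h'

/-- A region that meets neither of the two opened corners is untouched. This is why monogons and
bigons at other crossings survive a smoothing. -/
theorem smooth_reg_of {A : LinkDiagram X} {x z : A.Dart} (hx : ¬ A.reg z x)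
    (hx' : ¬ A.reg z (A.σ (A.σ x))) (w : A.Dart) : (A.smooth x).reg z w ↔ A.reg z w := by
  refine ⟨?_, Or.inl⟩
  rintro (h | ⟨h | h, -⟩)
  · exact h
  · exact absurd h hx
  · exact absurd h hx'

theorem smooth_outer_of {A : LinkDiagram X} {x z : A.Dart} (hx : ¬ A.reg z x)
    (hx' : ¬ A.reg z (A.σ (A.σ x))) (h : ¬ A.outer z) : ¬ (A.smooth x).outer z := by
  rintro ⟨w, hw, hwz⟩
  exact h ((A.outer_iff_of_reg
    ((smooth_reg_of hx hx' w).1 ((A.smooth x).reg.symm hwz))).2 hw)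

theorem IsMonogon.smooth {A : LinkDiagram X} {x z : A.Dart} (hz : A.IsMonogon z)
    (h : ¬ A.AtVertex x z) : (A.smooth x).IsMonogon z := by
  obtain ⟨h1, h2, h3, h4⟩ := hz
  have hx : ¬ A.reg z x := fun k => h (.inl (h3 _ k).symm)
  have hx' : ¬ A.reg z (A.σ (A.σ x)) := fun k => h (.inr (.inr (.inl (h3 _ k).symm)))
  refine ⟨isCrossing_smooth h1 h, ?_, fun y hy => h3 y ((smooth_reg_of hx hx' y).1 hy),
    smooth_outer_of hx hx' h4⟩
  rw [smooth_σ_of_not_atVertex h]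
  exact h2

theorem IsSpecialBigon.smooth {A : LinkDiagram X} {x z w : A.Dart} (hz : A.IsSpecialBigon z w)
    (h : ¬ A.AtVertex x z) (h' : ¬ A.AtVertex x w) : (A.smooth x).IsSpecialBigon z w := by
  obtain ⟨h1, h2, h3, h4, h5, h6, h7, h8⟩ := hz
  have hx : ¬ A.reg z x := fun k => ((h6 _).1 k).elim (fun e => h (.inl e.symm))
    fun e => h' (.inl e.symm)
  have hx' : ¬ A.reg z (A.σ (A.σ x)) := fun k => ((h6 _).1 k).elim
    (fun e => h (.inr (.inr (.inl e.symm)))) fun e => h' (.inr (.inr (.inl e.symm)))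
  refine ⟨isCrossing_smooth h1 h, isCrossing_smooth h2 h', ?_, ?_, ?_,
    fun y => (smooth_reg_of hx hx' y).trans (h6 y), smooth_outer_of hx hx' h7, h8⟩
  · rw [sameCycle_iff] at h3
    exact fun k => h3 (AtVertex.of_smooth ((sameCycle_iff _ _ _).1 k))
  · rw [smooth_σ_of_not_atVertex h']
    exact h4
  · rw [smooth_σ_of_not_atVertex h]
    exact h5

/-! ### Forgetting points against smoothing and against forgetting points -/

theorem smooth_σ_of_not_isCrossing {A : LinkDiagram X} {u : A.Dart} (h : A.σ (A.σ u) = u)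
    (x : A.Dart) : (A.smooth x).σ u = A.σ u := by
  have h4 := A.σ_four
  have inj : ∀ a b, A.σ a = A.σ b → a = b := fun a b h => A.σ.injective h
  rw [smooth_σ]
  grind

theorem Removable.smooth {A : LinkDiagram X} {u : A.Dart} (h : A.Removable u) (x : A.Dart) :
    (A.smooth x).Removable u := by
  have e := smooth_σ_of_not_isCrossing h.1 x
  have e' : (A.smooth x).σ (A.σ u) = u :=
    (smooth_σ_of_not_isCrossing (by rw [h.1]) x).trans h.1
  exact ⟨(congrArg (A.smooth x).σ e).trans e', fun k => h.2 (k.trans e)⟩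

/-- Forgetting a point commutes with smoothing. The last clause records that the bijection does not
move darts, which is needed to smooth once more afterwards. -/
theorem exists_delete_smooth_isIso (A : LinkDiagram X) {u : A.Dart} (h : A.Removable u)
    (x : (A.delete u h).Dart) :
    ∃ e : ((A.delete u h).smooth x).Dart ≃ ((A.smooth x.1).delete u (h.smooth x.1)).Dart,
      IsIso e ∧ ∀ z, (e z).1 = z.1 := by
  have e : (A.smooth x.1).σ u = A.σ u := smooth_σ_of_not_isCrossing h.1 _
  have hb : ∀ z : A.Dart, (A.smooth x.1).bypass u z = A.bypass u z := by
    intro z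
    unfold bypass
    rw [e]
    rfl
  have hσ : ∀ z : (A.delete u h).Dart,
      (A.smooth x.1).σ z.1 = (((A.delete u h).smooth x).σ z).1 := by
    intro z
    have hd : ∀ y : (A.delete u h).Dart, ((A.delete u h).σ y).1 = A.σ y.1 := fun _ => rfl
    have inj : ∀ y z : (A.delete u h).Dart, y.1 = z.1 → y = z := fun _ _ => Subtype.ext
    rw [smooth_σ, smooth_σ]
    grind
  have hiff : ∀ z : A.Dart, (z ≠ u ∧ z ≠ A.σ u) ↔ (z ≠ u ∧ z ≠ (A.smooth x.1).σ u) := by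
    intro z
    rw [e]
  refine ⟨Equiv.subtypeEquivRight hiff, ⟨fun z => Subtype.ext (hb z.1),
    fun z => Subtype.ext (hσ z), fun z hz => rfl, fun y z => Iff.rfl, fun z => ?_⟩, fun z => rfl⟩
  · change (∃ w, A.outer w ∧ (A.smooth x.1).reg w z.1) ↔ ∃ w : (A.delete u h).Dart,
      A.outer w.1 ∧ (A.smooth x.1).reg w.1 z.1
    constructor
    · rintro ⟨w, hw, hwz⟩
      exact ⟨⟨A.shift u w, A.shift_ne h w⟩, (A.outer_iff_of_reg (A.shift_reg h w)).2 hw,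
        (A.smooth x.1).reg.trans (Or.inl (A.shift_reg h w)) hwz⟩
    · rintro ⟨w, hw, hwz⟩
      exact ⟨w.1, hw, hwz⟩

/-- The last hypothesis says that the points at `u` and `w` are the only vertices of a circle
without crossings. One of them must stay, and it does not matter which: `shift` exchanges their
darts. -/
theorem delete_iso_delete_of_circle (A : LinkDiagram X) {u w : A.Dart} (hu : A.Removable u)
    (hw : A.Removable w) (hwu : w ≠ u ∧ w ≠ A.σ u) (h : A.bypass u w = A.σ w) :
    Iso (A.delete u hu) (A.delete w hw) := by
  obtain ⟨u1, u2⟩ := id hu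
  obtain ⟨w1, w2⟩ := id hw
  have a1 := A.α_α
  have a2 := A.α_ne
  have a3 := A.σ_ne
  have inj : ∀ a b, A.σ a = A.σ b → a = b := fun a b h => A.σ.injective h
  let e : {z : A.Dart // z ≠ u ∧ z ≠ A.σ u} ≃ {z : A.Dart // z ≠ w ∧ z ≠ A.σ w} :=
    { toFun z := ⟨A.shift w z.1, A.shift_ne hw z.1⟩
      invFun z := ⟨A.shift u z.1, A.shift_ne hu z.1⟩
      left_inv z := Subtype.ext <| by
        have := z.2
        unfold bypass at h
        change A.shift u (A.shift w z.1) = z.1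
        unfold shift
        grind
      right_inv z := Subtype.ext <| by
        have := z.2
        unfold bypass at h
        change A.shift w (A.shift u z.1) = z.1
        unfold shift
        grind }
  refine ⟨e, fun z => Subtype.ext ?_, fun z => Subtype.ext ?_, fun z hz => ?_, fun y z => ?_,
    fun z => A.outer_iff_of_reg (A.shift_reg hw z.1)⟩
  · have := z.2
    change A.bypass w (A.shift w z.1) = A.shift w (A.bypass u z.1)
    unfold bypass at *
    unfold shift
    grind
  · have := z.2
    change A.σ (A.shift w z.1) = A.shift w (A.σ z.1)
    unfold bypass at *
    unfold shift
    grind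
  · have hz' : A.σ (A.σ z.1) ≠ z.1 := fun h0 => hz (Subtype.ext h0)
    change A.isOver (A.shift w z.1) = A.isOver z.1
    rw [A.shift_of_ne (by grind)]
  · have hy := A.shift_reg hw y.1
    have hz := A.shift_reg hw z.1
    exact ⟨fun k => A.reg.trans (A.reg.symm hy) (A.reg.trans k hz),
      fun k => A.reg.trans hy (A.reg.trans k (A.reg.symm hz))⟩

open Classical in
theorem delete_delete_α (A : LinkDiagram X) {u : A.Dart} (hu : A.Removable u)
    {w : (A.delete u hu).Dart} (hw : (A.delete u hu).Removable w)
    (z : ((A.delete u hu).delete w hw).Dart) :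
    (((A.delete u hu).delete w hw).α z).1.1 =
      if A.bypass u z.1.1 = w.1 then A.bypass u (A.σ w.1) else
        if A.bypass u z.1.1 = A.σ w.1 then A.bypass u w.1 else A.bypass u z.1.1 := by
  have hd : ∀ y : (A.delete u hu).Dart, ((A.delete u hu).α y).1 = A.bypass u y.1 := fun _ => rfl
  have hs : ∀ y : (A.delete u hu).Dart, ((A.delete u hu).σ y).1 = A.σ y.1 := fun _ => rfl
  have inj : ∀ y z : (A.delete u hu).Dart, y.1 = z.1 → y = z := fun _ _ => Subtype.ext
  change ((A.delete u hu).bypass w z.1).1 = _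
  rw [bypass]
  grind

-- Distinct points can be forgotten in either order, unless they are the only two vertices on a
-- circle, where forgetting the first makes the second irremovable. The remaining case is that `u`
-- and `w` belong to the same point.
open Classical in
theorem joinable_delete_delete (A : LinkDiagram X) {u w : A.Dart} (hu : A.Removable u)
    (hw : A.Removable w) : Joinable (A.delete u hu) (A.delete w hw) := by
  obtain ⟨u1, u2⟩ := id hu
  obtain ⟨w1, w2⟩ := id hw
  have a1 := A.α_α
  have a2 := A.α_ne
  have a3 := A.σ_ne
  by_cases hwu : w ≠ u ∧ w ≠ A.σ u
  · have huw : u ≠ w ∧ u ≠ A.σ w := by grind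
    by_cases hr : A.bypass u w = A.σ w
    · exact (A.delete_iso_delete_of_circle hu hw hwu hr).joinable
    · have hr' : A.bypass w u ≠ A.σ u := by
        unfold bypass at *
        grind
      have k : (A.delete u hu).Removable ⟨w, hwu⟩ :=
        ⟨Subtype.ext w1, fun e => hr (congrArg Subtype.val e)⟩
      have k' : (A.delete w hw).Removable ⟨u, huw⟩ :=
        ⟨Subtype.ext u1, fun e => hr' (congrArg Subtype.val e)⟩
      refine Joinable.of_simplifies (Iso.joinable ?_) (simplifies_delete _ k)
        (simplifies_delete _ k')
      let e : ((A.delete u hu).delete ⟨w, hwu⟩ k).Dart ≃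
          ((A.delete w hw).delete ⟨u, huw⟩ k').Dart :=
        { toFun z := ⟨⟨z.1.1, fun e => z.2.1 (Subtype.ext e), fun e => z.2.2 (Subtype.ext e)⟩,
            fun e => z.1.2.1 (congrArg Subtype.val e), fun e => z.1.2.2 (congrArg Subtype.val e)⟩
          invFun z := ⟨⟨z.1.1, fun e => z.2.1 (Subtype.ext e), fun e => z.2.2 (Subtype.ext e)⟩,
            fun e => z.1.2.1 (congrArg Subtype.val e), fun e => z.1.2.2 (congrArg Subtype.val e)⟩
          left_inv _ := rfl
          right_inv _ := rfl }
      refine ⟨e, fun z => Subtype.ext (Subtype.ext ?_), fun z => rfl, fun _ _ => rfl,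
        fun _ _ => Iff.rfl, fun _ => Iff.rfl⟩
      refine (A.delete_delete_α hw k' (e z)).trans (Eq.trans ?_ (A.delete_delete_α hu k z).symm)
      have h1 : z.1.1 ≠ w := fun e => z.2.1 (Subtype.ext e)
      have h2 : z.1.1 ≠ A.σ w := fun e => z.2.2 (Subtype.ext e)
      have h3 := z.1.2
      change (if A.bypass w z.1.1 = u then A.bypass w (A.σ u) else
        if A.bypass w z.1.1 = A.σ u then A.bypass w u else A.bypass w z.1.1) = _
      unfold bypass at *
      grind
  · have hiff : ∀ z : A.Dart, (z ≠ u ∧ z ≠ A.σ u) ↔ (z ≠ w ∧ z ≠ A.σ w) := by grind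
    refine Iso.joinable ⟨Equiv.subtypeEquivRight hiff, fun z => Subtype.ext ?_, fun z => rfl,
      fun _ _ => rfl, fun _ _ => Iff.rfl, fun _ => Iff.rfl⟩
    change A.bypass w z.1 = A.bypass u z.1
    unfold bypass
    grind

/-! ### Bigons that are not special: either crossing may be kept -/

open Classical in
/-- For a bigon with corners `y` and `w`: turning the bigon over carries the darts at `w` to the
darts at `y`. -/
noncomputable def twist (C : LinkDiagram X) (y w a : C.Dart) : C.Dart :=
  if a = w then C.σ (C.σ y) else if a = C.σ w then C.σ (C.σ (C.σ y)) else
  if a = C.σ (C.σ w) then y else if a = C.σ (C.σ (C.σ w)) then C.σ y else a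

open Classical in
/-- For a bigon with corners `y` and `w`: a dart beside the region that contains the one on the
left of `a` after smoothing at `y`. -/
noncomputable def push (C : LinkDiagram X) (y w a : C.Dart) : C.Dart :=
  if a = w then C.σ (C.σ y) else a

/-- The corners at `y` and `w` are the corners of a bigon that is not special. -/
structure IsTwist (C : LinkDiagram X) (y w : C.Dart) : Prop where
  crossing_left : C.IsCrossing y
  crossing_right : C.IsCrossing w
  not_atVertex : ¬ C.AtVertex y w
  α_left : C.α y = C.σ w
  α_right : C.α w = C.σ y
  reg_iff : ∀ z, C.reg y z ↔ z = y ∨ z = w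
  not_outer : ¬ C.outer y
  isOver_eq : C.isOver y = C.isOver w

variable {C : LinkDiagram X} {y w : C.Dart}

theorem IsTwist.symm (h : C.IsTwist y w) : C.IsTwist w y := by
  have hyw : C.reg y w := (h.reg_iff w).2 (.inr rfl)
  refine ⟨h.crossing_right, h.crossing_left, fun k => h.not_atVertex k.symm, h.α_right, h.α_left,
    fun z => ?_, fun k => h.not_outer ((C.outer_iff_of_reg hyw).2 k), h.isOver_eq.symm⟩
  rw [or_comm, ← h.reg_iff]
  exact ⟨C.reg.trans hyw, C.reg.trans (C.reg.symm hyw)⟩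

theorem IsTwist.not_atVertex_twist (h : C.IsTwist y w) (a : C.Dart) :
    ¬ C.AtVertex w (C.twist y w a) := by
  have h1 := h.not_atVertex
  have h4 := C.σ_four
  have inj : ∀ a b, C.σ a = C.σ b → a = b := fun a b h => C.σ.injective h
  unfold AtVertex twist at *
  grind

theorem IsTwist.twist_twist (h : C.IsTwist y w) {a : C.Dart} (ha : ¬ C.AtVertex y a) :
    C.twist w y (C.twist y w a) = a := by
  have h1 := h.not_atVertex
  have h2 := h.crossing_left
  have h4 := C.σ_four
  have h5 := C.σ_ne
  have inj : ∀ a b, C.σ a = C.σ b → a = b := fun a b h => C.σ.injective h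
  unfold AtVertex twist IsCrossing at *
  grind

theorem IsTwist.twist_σ (h : C.IsTwist y w) (a : C.Dart) :
    C.twist y w (C.σ a) = C.σ (C.twist y w a) := by
  have h1 := h.not_atVertex
  have h2 := h.crossing_right
  have h4 := C.σ_four
  have h5 := C.σ_ne
  have inj : ∀ a b, C.σ a = C.σ b → a = b := fun a b h => C.σ.injective h
  unfold AtVertex twist IsCrossing at *
  grind

/-- `twist` matches corner `w` with the corner opposite to `y`, a shift by two, which preserves
over/under precisely because `y` and `w` have the same value of `isOver`. -/
theorem IsTwist.isOver_twist (h : C.IsTwist y w) (a : C.Dart) :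
    C.isOver (C.twist y w a) = C.isOver a := by
  have h1 := h.crossing_left
  have h2 := h.crossing_right
  have inj : ∀ a b, C.σ a = C.σ b → a = b := fun a b h => C.σ.injective h
  have o1 := C.isOver_σ y h1
  have o2 := C.isOver_σ (C.σ y) fun k => h1 (inj _ _ k)
  have o3 := C.isOver_σ (C.σ (C.σ y)) fun k => h1 (inj _ _ (inj _ _ k))
  have o4 := C.isOver_σ w h2
  have o5 := C.isOver_σ (C.σ w) fun k => h2 (inj _ _ k)
  have o6 := C.isOver_σ (C.σ (C.σ w)) fun k => h2 (inj _ _ (inj _ _ k))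
  have o := h.isOver_eq
  unfold twist
  grind

/-- Smoothing at `y` merges the bigon with the region opposite. The bigon contains only the darts
`y` and `w`, and `y` will be forgotten, so redirecting `w` alone accounts for the change. -/
theorem IsTwist.smooth_reg_iff (h : C.IsTwist y w) {a b : C.Dart} (ha : a ≠ y) (hb : b ≠ y) :
    (C.smooth y).reg a b ↔ C.reg (C.push y w a) (C.push y w b) := by
  have hr : ∀ z, C.reg z y ↔ z = y ∨ z = w := fun z =>
    ⟨fun k => (h.reg_iff z).1 (C.reg.symm k), fun k => C.reg.symm ((h.reg_iff z).2 k)⟩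
  have hwy : C.reg w y := (hr w).2 (.inr rfl)
  have key : ∀ a, a ≠ y → (C.smooth y).reg a (C.push y w a) := by
    intro a ha
    unfold push
    split_ifs with e
    · subst e
      exact Or.inr ⟨Or.inl hwy, Or.inr (C.reg.refl _)⟩
    · exact (C.smooth y).reg.refl a
  have key' : ∀ a, a ≠ y → C.reg a y → C.push y w a = C.σ (C.σ y) := by
    intro a ha k
    rw [push, if_pos (((hr a).1 k).resolve_left ha)]
  have key2 : ∀ a, a ≠ y → C.reg a (C.σ (C.σ y)) → C.reg (C.push y w a) (C.σ (C.σ y)) := by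
    intro a ha k
    unfold push
    split_ifs
    · exact C.reg.refl _
    · exact k
  have key3 : ∀ a, a ≠ y → (C.reg a y ∨ C.reg a (C.σ (C.σ y))) →
      C.reg (C.push y w a) (C.σ (C.σ y)) := fun a ha k =>
    k.elim (fun k => key' a ha k ▸ C.reg.refl _) (key2 a ha)
  constructor
  · rintro (k | ⟨k, k'⟩)
    · by_cases hay : C.reg a y
      · rw [key' a ha hay, key' b hb (C.reg.trans (C.reg.symm k) hay)]
      · have hby : ¬ C.reg b y := fun k' => hay (C.reg.trans k k')
        rw [push, if_neg fun e => hay ((hr a).2 (.inr e)), push,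
          if_neg fun e => hby ((hr b).2 (.inr e))]
        exact k
    · exact C.reg.trans (key3 a ha k) (C.reg.symm (key3 b hb k'))
  · intro k
    exact (C.smooth y).reg.trans (key a ha) ((C.smooth y).reg.trans (Or.inl k)
      ((C.smooth y).reg.symm (key b hb)))

theorem IsTwist.smooth_outer_iff (h : C.IsTwist y w) {a : C.Dart} (ha : a ≠ y) :
    (C.smooth y).outer a ↔ C.outer (C.push y w a) := by
  have hyw : C.reg y w := (h.reg_iff w).2 (.inr rfl)
  constructor
  · rintro ⟨z, hz, hza⟩
    have hzy : ¬ C.reg z y := fun k => h.not_outer ((C.outer_iff_of_reg k).1 hz)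
    have hzw : ¬ C.reg z w := fun k => hzy (C.reg.trans k (C.reg.symm hyw))
    have := (h.smooth_reg_iff (fun e : z = y => hzy (e ▸ C.reg.refl _)) ha).1 hza
    rw [push, if_neg fun e : z = w => hzw (e ▸ C.reg.refl _)] at this
    exact (C.outer_iff_of_reg this).1 hz
  · intro k
    have hp : C.push y w a ≠ y := fun e => h.not_outer (e ▸ k)
    refine ⟨_, k, (h.smooth_reg_iff hp ha).2 ?_⟩
    have hw : C.push y w a ≠ w := fun e => h.not_outer ((C.outer_iff_of_reg hyw).2 (e ▸ k))
    rw [push, if_neg hw]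

theorem IsTwist.push_twist (h : C.IsTwist y w) {a : C.Dart} (ha : ¬ C.AtVertex y a) :
    C.reg (C.push w y (C.twist y w a)) (C.push y w a) := by
  have h1 := h.not_atVertex
  have h2 := h.crossing_left
  have h4 := C.σ_four
  have h5 := C.σ_ne
  have inj : ∀ a b, C.σ a = C.σ b → a = b := fun a b h => C.σ.injective h
  -- The region on the outer side of a bigon edge has corners at both crossings: `c1` and `c2`
  -- identify these for the edges of `y` and of `w`.
  have c1 := C.reg_corner (C.σ (C.σ (C.σ y)))
  have c2 := C.reg_corner (C.σ (C.σ (C.σ w)))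
  rw [h4, h.α_left] at c1
  rw [h4, h.α_right] at c2
  have key : C.push w y (C.twist y w a) = C.push y w a ∨
      (C.push w y (C.twist y w a) = C.σ (C.σ (C.σ y)) ∧ C.push y w a = C.σ w) ∨
      (C.push w y (C.twist y w a) = C.σ y ∧ C.push y w a = C.σ (C.σ (C.σ w))) := by
    clear c1 c2
    unfold AtVertex twist push IsCrossing at *
    grind
  rcases key with e | ⟨e, e'⟩ | ⟨e, e'⟩
  · rw [e]
  · rw [e, e']
    exact C.reg.symm c1
  · rwa [e, e']

theorem smooth_σ_self (C : LinkDiagram X) (y : C.Dart) :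
    (C.smooth y).σ y = C.σ (C.σ (C.σ y)) := by rw [smooth_σ, if_pos rfl]

theorem smooth_σ_next (C : LinkDiagram X) (y : C.Dart) :
    (C.smooth y).σ (C.σ y) = C.σ (C.σ y) := by
  have h4 := C.σ_four
  have h5 := C.σ_ne
  have inj : ∀ a b, C.σ a = C.σ b → a = b := fun a b h => C.σ.injective h
  rw [smooth_σ]
  grind

theorem smooth_σ_next_next (C : LinkDiagram X) (y : C.Dart) :
    (C.smooth y).σ (C.σ (C.σ y)) = C.σ y := by
  have h4 := C.σ_four
  rw [smooth_σ]
  grind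

theorem smooth_σ_prev (C : LinkDiagram X) (y : C.Dart) :
    (C.smooth y).σ (C.σ (C.σ (C.σ y))) = y := by
  have h4 := C.σ_four
  have h5 := C.σ_ne
  have inj : ∀ a b, C.σ a = C.σ b → a = b := fun a b h => C.σ.injective h
  rw [smooth_σ]
  grind

theorem removable_smooth_self {y : C.Dart} (h : C.α y ≠ C.σ (C.σ (C.σ y))) :
    (C.smooth y).Removable y :=
  ⟨(congrArg (C.smooth y).σ (C.smooth_σ_self y)).trans (C.smooth_σ_prev y),
    fun k => h (k.trans (C.smooth_σ_self y))⟩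

theorem removable_smooth_next {y : C.Dart} (h : C.α (C.σ y) ≠ C.σ (C.σ y)) :
    (C.smooth y).Removable (C.σ y) :=
  ⟨(congrArg (C.smooth y).σ (C.smooth_σ_next y)).trans (C.smooth_σ_next_next y),
    fun k => h (k.trans (C.smooth_σ_next y))⟩

open Classical in
theorem smooth_bypass (C : LinkDiagram X) (y z : C.Dart) : (C.smooth y).bypass y z =
    if C.α z = y then C.α (C.σ (C.σ (C.σ y))) else
      if C.α z = C.σ (C.σ (C.σ y)) then C.α y else C.α z := by
  unfold bypass
  rw [smooth_σ_self]
  rfl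

theorem IsCrossing.next_ne (h : C.IsCrossing y) : C.σ y ≠ y ∧ C.σ y ≠ (C.smooth y).σ y := by
  rw [smooth_σ_self]
  exact ⟨C.σ_ne y, fun k => h (C.σ.injective k).symm⟩

/-- After smoothing at `y`, the two new bivalent points can be forgotten, provided that the edges
of `y` and `σ y` both lead to other vertices. -/
theorem removable_next (hy : C.IsCrossing y) (h0 : ¬ C.AtVertex y (C.α y))
    (h : ¬ C.AtVertex y (C.α (C.σ y))) :
    ((C.smooth y).delete y (removable_smooth_self fun k => h0 (.inr (.inr (.inr k))))).Removable
      ⟨C.σ y, hy.next_ne⟩ := by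
  have h1 : C.α (C.σ y) ≠ C.σ (C.σ y) := fun k => h (.inr (.inr (.inl k)))
  have r := removable_smooth_next h1
  refine ⟨Subtype.ext r.1, fun k => ?_⟩
  have e : (C.smooth y).bypass y (C.σ y) = (C.smooth y).σ (C.σ y) := congrArg Subtype.val k
  rw [smooth_bypass, if_neg fun k => h (.inl k), if_neg fun k => h (.inr (.inr (.inr k))),
    smooth_σ_next] at e
  exact h1 e

/-- The diagram smoothed at `y`, without the two new bivalent points. -/
noncomputable def resolve (C : LinkDiagram X) (y : C.Dart) (hy : C.IsCrossing y)
    (h0 : ¬ C.AtVertex y (C.α y)) (h : ¬ C.AtVertex y (C.α (C.σ y))) : LinkDiagram X :=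
  ((C.smooth y).delete y (removable_smooth_self fun k => h0 (.inr (.inr (.inr k))))).delete
    ⟨C.σ y, hy.next_ne⟩ (removable_next hy h0 h)

section
variable {hy : C.IsCrossing y} {h0 : ¬ C.AtVertex y (C.α y)}
  {h : ¬ C.AtVertex y (C.α (C.σ y))}

theorem simplifies_resolve : Simplifies (C.smooth y) (C.resolve y hy h0 h) :=
  .trans (simplifies_delete _ (removable_smooth_self fun k => h0 (.inr (.inr (.inr k)))))
    (simplifies_delete _ (removable_next hy h0 h))

/-- The dart of `C` that gives a dart of the resolved diagram. -/
def ofResolve (z : (C.resolve y hy h0 h).Dart) : C.Dart := z.1.1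

theorem ofResolve_injective : Function.Injective (ofResolve : (C.resolve y hy h0 h).Dart → _) :=
  fun _ _ k => Subtype.ext (Subtype.ext k)

theorem ofResolve_not_atVertex (z : (C.resolve y hy h0 h).Dart) :
    ¬ C.AtVertex y (ofResolve z) := by
  rintro (k | k | k | k)
  · exact z.1.2.1 k
  · exact z.2.1 (Subtype.ext k)
  · exact z.2.2 (Subtype.ext (k.trans (C.smooth_σ_next y).symm))
  · exact z.1.2.2 (k.trans (C.smooth_σ_self y).symm)

/-- The dart of the resolved diagram given by a dart of `C`. -/
def toResolve (a : C.Dart) (ha : ¬ C.AtVertex y a) : (C.resolve y hy h0 h).Dart :=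
  ⟨⟨a, fun k => ha (.inl k), fun k => ha (.inr (.inr (.inr (k.trans (C.smooth_σ_self y)))))⟩,
    fun k => ha (.inr (.inl (congrArg Subtype.val k))),
    fun k => ha (.inr (.inr (.inl ((congrArg Subtype.val k).trans (C.smooth_σ_next y)))))⟩

theorem ofResolve_toResolve (a : C.Dart) (ha : ¬ C.AtVertex y a) :
    ofResolve (toResolve a ha : (C.resolve y hy h0 h).Dart) = a := rfl

theorem ofResolve_σ (z : (C.resolve y hy h0 h).Dart) :
    ofResolve ((C.resolve y hy h0 h).σ z) = C.σ (ofResolve z) :=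
  smooth_σ_of_not_atVertex (ofResolve_not_atVertex z)

-- An edge that runs into the smoothed crossing continues through a forgotten point. The inner
-- conditions treat an edge joining `σ² y` to `σ³ y`, which forces a passage through both points;
-- the edges of `y` and `σ y` leave the vertex by `h0` and `h`, so nothing further can happen.
open Classical in
theorem ofResolve_α (z : (C.resolve y hy h0 h).Dart) :
    ofResolve ((C.resolve y hy h0 h).α z) =
      if C.α (ofResolve z) = y then
        if C.α (C.σ (C.σ (C.σ y))) = C.σ (C.σ y) then C.α (C.σ y) else C.α (C.σ (C.σ (C.σ y)))
      else if C.α (ofResolve z) = C.σ y then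
        if C.α (C.σ (C.σ y)) = C.σ (C.σ (C.σ y)) then C.α y else C.α (C.σ (C.σ y))
      else if C.α (ofResolve z) = C.σ (C.σ y) then C.α (C.σ y)
      else if C.α (ofResolve z) = C.σ (C.σ (C.σ y)) then C.α y
      else C.α (ofResolve z) := by
  have e := delete_delete_α _ _ (removable_next hy h0 h) z
  change ofResolve ((C.resolve y hy h0 h).α z) =
    if (C.smooth y).bypass y (ofResolve (C := C) z) = C.σ y then
      (C.smooth y).bypass y ((C.smooth y).σ (C.σ y)) else
    if (C.smooth y).bypass y (ofResolve (C := C) z) = (C.smooth y).σ (C.σ y) then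
      (C.smooth y).bypass y (C.σ y) else (C.smooth y).bypass y (ofResolve (C := C) z) at e
  simp only [smooth_σ_next, smooth_bypass] at e
  rw [e]
  have a1 := C.α_α
  have a2 := C.α_ne
  have h5 := C.σ_ne
  have inj : ∀ a b, C.σ a = C.σ b → a = b := fun a b h => C.σ.injective h
  have hz := ofResolve_not_atVertex z
  unfold AtVertex IsCrossing at *
  clear e
  generalize ofResolve z = t at *
  grind

theorem resolve_isOver (z : (C.resolve y hy h0 h).Dart) :
    (C.resolve y hy h0 h).isOver z = C.isOver (ofResolve z) := rfl

theorem resolve_reg (z z' : (C.resolve y hy h0 h).Dart) :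
    (C.resolve y hy h0 h).reg z z' ↔
      (C.smooth y).reg (ofResolve (C := C) z) (ofResolve (C := C) z') := Iff.rfl

theorem resolve_outer (z : (C.resolve y hy h0 h).Dart) :
    (C.resolve y hy h0 h).outer z ↔ (C.smooth y).outer (ofResolve (C := C) z) := Iff.rfl

end

theorem IsTwist.α_left_not_atVertex (h : C.IsTwist y w) : ¬ C.AtVertex y (C.α y) := by
  rw [h.α_left]
  exact fun k => h.not_atVertex (k.trans (AtVertex.symm (.inr (.inl rfl))))

theorem IsTwist.α_next_not_atVertex (h : C.IsTwist y w) : ¬ C.AtVertex y (C.α (C.σ y)) := by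
  rw [← h.α_right, C.α_α]
  exact h.not_atVertex

open Classical in
/-- How the edges of the two resolutions of a bigon that is not special correspond: `a` is the
involution of edge ends, `y₀, …, y₃` and `w₀, …, w₃` are the darts at the two crossings. -/
theorem twist_edge {T : Type} (a : T → T) (h : ∀ t, a (a t) = t) (hne : ∀ t, a t ≠ t)
    {y₀ y₁ y₂ y₃ w₀ w₁ w₂ w₃ : T}
    (hd : [y₀, y₁, y₂, y₃, w₀, w₁, w₂, w₃].Nodup) (hy : a y₀ = w₁) (hw : a w₀ = y₁)
    (f : T → T) (hf : ∀ t, f t = if t = w₀ then y₂ else if t = w₁ then y₃ else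
      if t = w₂ then y₀ else if t = w₃ then y₁ else t)
    (p q : T → T)
    (hp : ∀ t, p t = if a t = y₀ then if a y₃ = y₂ then a y₁ else a y₃ else
      if a t = y₁ then if a y₂ = y₃ then a y₀ else a y₂ else
      if a t = y₂ then a y₁ else if a t = y₃ then a y₀ else a t)
    (hq : ∀ t, q t = if a t = w₀ then if a w₃ = w₂ then a w₁ else a w₃ else
      if a t = w₁ then if a w₂ = w₃ then a w₀ else a w₂ else
      if a t = w₂ then a w₁ else if a t = w₃ then a w₀ else a t)
    {t : T} (ht : ¬ (t = y₀ ∨ t = y₁ ∨ t = y₂ ∨ t = y₃)) : q (f t) = f (p t) := by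
  simp only [List.nodup_cons, List.mem_cons, not_or, List.not_mem_nil] at hd
  have hy' : a w₁ = y₀ := by rw [← hy, h]
  have hw' : a y₁ = w₀ := by rw [← hw, h]
  by_cases t0 : t = w₀
  · subst t0
    have e1 : f t = y₂ := by grind
    have e2 : p t = if a y₂ = y₃ then w₁ else a y₂ := by grind
    rw [e1, e2, hq, hf]
    clear hp hq hf
    grind
  by_cases t1 : t = w₁
  · subst t1
    have e1 : f t = y₃ := by grind
    have e2 : p t = if a y₃ = y₂ then w₀ else a y₃ := by grind
    rw [e1, e2, hq, hf]
    clear hp hq hf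
    grind
  by_cases t2 : t = w₂
  · subst t2
    have e1 : f t = y₀ := by grind
    have e2 : q y₀ = if a t = w₃ then y₁ else a t := by grind
    rw [e1, e2, hf, hp]
    clear hp hq hf
    grind
  by_cases t3 : t = w₃
  · subst t3
    have e1 : f t = y₁ := by grind
    have e2 : q y₁ = if a t = w₂ then y₀ else a t := by grind
    rw [e1, e2, hf, hp]
    clear hp hq hf
    grind
  have e1 : f t = t := by grind
  rw [e1, hq, hf, hp]
  clear hp hq hf
  grind

/-- Smoothing one crossing of the bigon prolongs the bigon edges at the other crossing to the outer
ends of the smoothed one. In both resolutions a single crossing joins the same four outer ends, and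
`twist` is the identification. -/
theorem IsTwist.resolve_iso (h : C.IsTwist y w) :
    Iso (C.resolve y h.crossing_left h.α_left_not_atVertex h.α_next_not_atVertex)
      (C.resolve w h.symm.crossing_left h.symm.α_left_not_atVertex
        h.symm.α_next_not_atVertex) := by
  let e : (C.resolve y h.crossing_left h.α_left_not_atVertex h.α_next_not_atVertex).Dart ≃
      (C.resolve w h.symm.crossing_left h.symm.α_left_not_atVertex
        h.symm.α_next_not_atVertex).Dart :=
    { toFun z := toResolve (C.twist y w (ofResolve z)) (h.not_atVertex_twist _)
      invFun z := toResolve (C.twist w y (ofResolve z)) (h.symm.not_atVertex_twist _)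
      left_inv z := ofResolve_injective (h.twist_twist (ofResolve_not_atVertex z))
      right_inv z := ofResolve_injective (h.symm.twist_twist (ofResolve_not_atVertex z)) }
  have he : ∀ z, ofResolve (e z) = C.twist y w (ofResolve z) := fun z => rfl
  have ney : ∀ z : (C.resolve y h.crossing_left h.α_left_not_atVertex
      h.α_next_not_atVertex).Dart, ofResolve z ≠ y := fun z k => ofResolve_not_atVertex z (.inl k)
  have new : ∀ z, ofResolve (e z) ≠ w := fun z k => ofResolve_not_atVertex (e z) (.inl k)
  have hp : ∀ z, C.reg (C.push w y (ofResolve (e z))) (C.push y w (ofResolve z)) := fun z =>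
    h.push_twist (ofResolve_not_atVertex z)
  refine ⟨e, fun z => ofResolve_injective ?_, fun z => ofResolve_injective ?_, fun z hz => ?_,
    fun z z' => ?_, fun z => ?_⟩
  · rw [ofResolve_α, he, he, ofResolve_α]
    refine twist_edge C.α C.α_α C.α_ne (y₀ := y) (w₀ := w) ?_ h.α_left h.α_right (C.twist y w)
      (fun t => rfl) (fun t => _) (fun t => _) (fun t => rfl) (fun t => rfl)
      (ofResolve_not_atVertex z)
    have h1 := h.not_atVertex
    have h2 := h.crossing_left
    have h3 := h.crossing_right
    have h4 := C.σ_four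
    have h5 := C.σ_ne
    have inj : ∀ a b, C.σ a = C.σ b → a = b := fun a b h => C.σ.injective h
    unfold AtVertex IsCrossing at *
    clear he hp
    simp only [List.nodup_cons, List.mem_cons, not_or, List.not_mem_nil]
    grind
  · rw [ofResolve_σ, he, he, ofResolve_σ, h.twist_σ]
  · rw [resolve_isOver, resolve_isOver, he, h.isOver_twist]
  · rw [resolve_reg, resolve_reg, h.smooth_reg_iff (ney z) (ney z'),
      h.symm.smooth_reg_iff (new z) (new z')]
    exact ⟨fun k => C.reg.trans (C.reg.symm (hp z)) (C.reg.trans k (hp z')),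
      fun k => C.reg.trans (hp z) (C.reg.trans k (C.reg.symm (hp z')))⟩
  · rw [resolve_outer, resolve_outer, h.smooth_outer_iff (ney z), h.symm.smooth_outer_iff (new z)]
    exact C.outer_iff_of_reg (hp z)

theorem IsTwist.joinable (h : C.IsTwist y w) : Joinable (C.smooth y) (C.smooth w) :=
  h.resolve_iso.joinable.of_simplifies simplifies_resolve simplifies_resolve

/-! ### Local confluence: forgetting a point against a move -/

section
variable {A : LinkDiagram X} {u : A.Dart}

theorem IsCrossing.avoids {x : A.Dart} (hx : A.IsCrossing x) (h : A.Removable u) :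
    x ≠ u ∧ x ≠ A.σ u :=
  ⟨fun k => hx (k ▸ h.1), fun k => hx (by rw [k, h.1])⟩

theorem IsCrossing.next {x : A.Dart} (hx : A.IsCrossing x) : A.IsCrossing (A.σ x) :=
  fun k => hx (A.σ.injective k)

/-- The edges of monogons and special bigons end at crossings, so forgetting a bivalent point leaves
them unchanged. -/
theorem bypass_of_isCrossing {z : A.Dart} (hz : A.IsCrossing (A.α z)) (h : A.Removable u) :
    A.bypass u z = A.α z := by
  rw [bypass, if_neg (hz.avoids h).1, if_neg (hz.avoids h).2]

theorem isCrossing_delete {h : A.Removable u} (x : (A.delete u h).Dart) :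
    (A.delete u h).IsCrossing x ↔ A.IsCrossing x.1 :=
  not_congr Subtype.ext_iff

theorem atVertex_delete {h : A.Removable u} (x y : (A.delete u h).Dart) :
    (A.delete u h).AtVertex x y ↔ A.AtVertex x.1 y.1 :=
  or_congr Subtype.ext_iff (or_congr Subtype.ext_iff (or_congr Subtype.ext_iff Subtype.ext_iff))

theorem IsMonogon.delete {x : A.Dart} (hx : A.IsMonogon x) (h : A.Removable u) :
    (A.delete u h).IsMonogon ⟨x, hx.1.avoids h⟩ := by
  obtain ⟨h1, h2, h3, h4⟩ := hx
  refine ⟨(isCrossing_delete _).2 h1, Subtype.ext ?_, fun y hy => Subtype.ext (h3 y.1 hy), h4⟩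
  exact (bypass_of_isCrossing (by rw [h2]; exact h1.next) h).trans h2

theorem IsSpecialBigon.delete {x y : A.Dart} (hxy : A.IsSpecialBigon x y) (h : A.Removable u) :
    (A.delete u h).IsSpecialBigon ⟨x, hxy.1.avoids h⟩ ⟨y, hxy.2.1.avoids h⟩ := by
  obtain ⟨h1, h2, h3, h4, h5, h6, h7, h8⟩ := hxy
  have e1 : A.bypass u x = A.α x := bypass_of_isCrossing (by rw [h4]; exact h2.next) h
  have e2 : A.bypass u y = A.α y := bypass_of_isCrossing (by rw [h5]; exact h1.next) h
  refine ⟨(isCrossing_delete _).2 h1, (isCrossing_delete _).2 h2, ?_, Subtype.ext (e1.trans h4),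
    Subtype.ext (e2.trans h5), fun z => ?_, h7, ?_⟩
  · rw [sameCycle_iff] at h3
    exact fun k => h3 ((atVertex_delete _ _).1 ((sameCycle_iff _ _ _).1 k))
  · exact (h6 z.1).trans (or_congr ⟨fun k => Subtype.ext k, congrArg Subtype.val⟩
      ⟨fun k => Subtype.ext k, congrArg Subtype.val⟩)
  · exact h8.trans (congrArg A.isOver e1.symm)

theorem simplifies_smooth_delete (h : A.Removable u) (x : (A.delete u h).Dart) :
    Simplifies (A.smooth x.1) ((A.delete u h).smooth x) := by
  obtain ⟨e, he, -⟩ := A.exists_delete_smooth_isIso h x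
  exact .trans (simplifies_delete _ (h.smooth x.1)) he.iso.symm.simplifies

theorem simplifies_smooth_smooth_delete (h : A.Removable u) (x y : (A.delete u h).Dart) :
    Simplifies ((A.smooth x.1).smooth y.1) (((A.delete u h).smooth x).smooth y) := by
  obtain ⟨e, he, hv⟩ := A.exists_delete_smooth_isIso h x
  -- The second smoothing is naturally based at `(e y).1`, known to be `y.1` only through `hv`; the
  -- base dart is generalised to make the substitution possible.
  have key : ∀ t : A.Dart, (e y).1 = t →
      Simplifies ((A.smooth x.1).smooth t)
        (((A.smooth x.1).delete u (h.smooth x.1)).smooth (e y)) := by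
    rintro _ rfl
    exact simplifies_smooth_delete (h.smooth x.1) (e y)
  exact (key y.1 (hv y)).trans (he.smooth y).iso.symm.simplifies

theorem joinable_delete_monogon (h : A.Removable u) {x : A.Dart} (hx : A.IsMonogon x) :
    Joinable (A.delete u h) (A.smooth x) :=
  ⟨_, (hx.delete h).simplifies, simplifies_smooth_delete h ⟨x, hx.1.avoids h⟩⟩

theorem joinable_delete_bigon (h : A.Removable u) {x y : A.Dart} (hxy : A.IsSpecialBigon x y) :
    Joinable (A.delete u h) ((A.smooth x).smooth y) :=
  ⟨_, (hxy.delete h).simplifies,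
    simplifies_smooth_smooth_delete h ⟨x, hxy.1.avoids h⟩ ⟨y, hxy.2.1.avoids h⟩⟩

end

/-! ### Local confluence: a move against a move -/

section
variable {A : LinkDiagram X} {x y z w : A.Dart}

theorem joinable_monogon_monogon (hx : A.IsMonogon x) (hz : A.IsMonogon z) :
    Joinable (A.smooth x) (A.smooth z) := by
  by_cases h : A.AtVertex x z
  · have h1 := hx.1
    have h2 := hx.2.1
    have h3 := hz.2.1
    have h4 := A.σ_four
    have a1 := A.α_α
    -- Adjacent corners cannot both be monogons: the loop at `x` uses `σ x`, whose edge would have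
    -- to lead to both `x` and `σ² x`.
    have : z = x ∨ z = A.σ (A.σ x) := by
      unfold AtVertex IsCrossing at *
      grind
    rcases this with rfl | rfl
    · exact (Iso.refl _).joinable
    · exact (A.smooth_opposite x).iso.joinable.symm
  · exact (A.smooth_smooth_comm h).iso.joinable.of_simplifies (hz.smooth h).simplifies
      (hx.smooth fun k => h k.symm).simplifies

/-- Smoothing at `z` commutes with smoothing at `x` and at `y`. -/
theorem smooth_smooth_smooth_comm (hxz : ¬ A.AtVertex x z) (hyz : ¬ A.AtVertex y z) :
    IsIso (A := ((A.smooth x).smooth y).smooth z) (B := ((A.smooth z).smooth x).smooth y)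
      (Equiv.refl A.Dart) := by
  have h1 := (A.smooth x).smooth_smooth_comm (x := y) (y := z) fun k => hyz k.of_smooth
  have h2 := (A.smooth_smooth_comm hxz).smooth y
  exact ⟨fun _ => rfl, fun t => (h2.σ t).trans (h1.σ t), fun _ _ => rfl,
    fun s t => (h2.reg s t).trans (h1.reg s t), fun t => (h2.outer t).trans (h1.outer t)⟩

theorem IsSpecialBigon.not_atVertex (h : A.IsSpecialBigon x y) : ¬ A.AtVertex x y := by
  rw [← sameCycle_iff]
  exact h.2.2.1

theorem IsSpecialBigon.smooth_comm (h : A.IsSpecialBigon x y) :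
    IsIso (A := (A.smooth x).smooth y) (B := (A.smooth y).smooth x) (Equiv.refl A.Dart) :=
  A.smooth_smooth_comm h.not_atVertex

theorem IsSpecialBigon.α_not_atVertex (h : A.IsSpecialBigon x y) : ¬ A.AtVertex x (A.α x) := by
  rw [h.2.2.2.1]
  exact fun k => h.not_atVertex (k.trans (AtVertex.symm (.inr (.inl rfl))))

theorem IsSpecialBigon.α_next_not_atVertex (h : A.IsSpecialBigon x y) :
    ¬ A.AtVertex x (A.α (A.σ x)) := by
  rw [← h.2.2.2.2.1, A.α_α]
  exact h.not_atVertex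

theorem simplifies_smooth_resolve {hx : A.IsCrossing x} {h0 : ¬ A.AtVertex x (A.α x)}
    {h : ¬ A.AtVertex x (A.α (A.σ x))} (hy : ¬ A.AtVertex x y) :
    Simplifies ((A.smooth x).smooth y) ((A.resolve x hx h0 h).smooth (toResolve y hy)) :=
  .trans (simplifies_smooth_delete (A := A.smooth x) _
    (toResolve (hy := hx) (h0 := h0) (h := h) y hy).1)
    (simplifies_smooth_delete (removable_next hx h0 h) (toResolve y hy))

theorem isCrossing_resolve {hx : A.IsCrossing x} {h0 : ¬ A.AtVertex x (A.α x)}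
    {h : ¬ A.AtVertex x (A.α (A.σ x))} (t : (A.resolve x hx h0 h).Dart) :
    (A.resolve x hx h0 h).IsCrossing t ↔ A.IsCrossing (ofResolve t) := by
  unfold IsCrossing
  rw [← ofResolve_injective.ne_iff, ofResolve_σ, ofResolve_σ]

theorem atVertex_resolve {hx : A.IsCrossing x} {h0 : ¬ A.AtVertex x (A.α x)}
    {h : ¬ A.AtVertex x (A.α (A.σ x))} (s t : (A.resolve x hx h0 h).Dart) :
    (A.resolve x hx h0 h).AtVertex s t ↔ A.AtVertex (ofResolve s) (ofResolve t) := by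
  unfold AtVertex
  simp only [← ofResolve_injective.eq_iff, ofResolve_σ]

/-- The region created by the channel is the union of the regions at its two ends. -/
theorem smooth_reg_corner_iff (A : LinkDiagram X) {x y : A.Dart} (h : A.reg y x) (t : A.Dart) :
    (A.smooth x).reg y t ↔ A.reg x t ∨ A.reg (A.σ (A.σ x)) t := by
  constructor
  · rintro (k | ⟨-, k | k⟩)
    · exact .inl (A.reg.trans (A.reg.symm h) k)
    · exact .inl (A.reg.symm k)
    · exact .inr (A.reg.symm k)
  · intro k
    exact Or.inr ⟨.inl h, k.imp A.reg.symm A.reg.symm⟩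

theorem smooth_not_outer (A : LinkDiagram X) {x y : A.Dart} (h : A.reg y x)
    (h1 : ¬ A.outer x) (h2 : ¬ A.outer (A.σ (A.σ x))) : ¬ (A.smooth x).outer y := by
  rintro ⟨t, ht, hty⟩
  rcases (A.smooth_reg_corner_iff h t).1 ((A.smooth x).reg.symm hty) with k | k
  · exact h1 ((A.outer_iff_of_reg k).2 ht)
  · exact h2 ((A.outer_iff_of_reg k).2 ht)

/-- Opening the monogon also opens the bigon at `x`, by `smooth_opposite`. The loop of the monogon
connects the two bigon edges, and the bigon becomes a monogon at `y`; opening it completes the bigon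
move. -/
theorem joinable_monogon_bigon_of_opposite (h : A.IsSpecialBigon x y)
    (hz : A.IsMonogon (A.σ (A.σ x))) :
    Joinable (A.smooth (A.σ (A.σ x))) ((A.smooth x).smooth y) := by
  obtain ⟨h1, h2, -, h4, h5, h6, h7, h8⟩ := id h
  have hxy := h.not_atVertex
  have hreg : A.reg y x := A.reg.symm ((h6 y).2 (.inr rfl))
  let y' : (A.resolve x h1 h.α_not_atVertex h.α_next_not_atVertex).Dart := toResolve y hxy
  have hm : (A.resolve x h1 h.α_not_atVertex h.α_next_not_atVertex).IsMonogon y' := by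
    refine ⟨(isCrossing_resolve _).2 h2, ofResolve_injective ?_,
      fun t ht => ofResolve_injective ?_, A.smooth_not_outer hreg h7 hz.2.2.2⟩
    · rw [ofResolve_α, ofResolve_σ, ofResolve_toResolve, h5,
        if_neg (A.σ_ne x), if_pos rfl, if_pos hz.2.1, h4]
    · have hv := ofResolve_not_atVertex t
      rcases (A.smooth_reg_corner_iff hreg _).1 ht with k | k
      · exact ((h6 _).1 k).resolve_left fun k => hv (.inl k)
      · exact absurd (.inr (.inr (.inl (hz.2.2.1 _ k)))) hv
  refine ⟨_, .trans (A.smooth_opposite x).iso.simplifies (simplifies_resolve.trans hm.simplifies),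
    simplifies_smooth_resolve hxy⟩

theorem joinable_monogon_bigon_of_atVertex (h : A.IsSpecialBigon x y) (hz : A.IsMonogon z)
    (hxz : A.AtVertex x z) : Joinable (A.smooth z) ((A.smooth x).smooth y) := by
  -- The edges of `x` and `σ x` lead to the crossing of `y`, so a loop at the crossing of `x` can
  -- only use the other two darts.
  have : z = A.σ (A.σ x) := by
    obtain ⟨h1, h2, -, h4, h5, h6, h7, h8⟩ := id h
    have hxy := h.not_atVertex
    have k1 := hz.1
    have k2 := hz.2.1
    have k4 := A.σ_four
    have a1 := A.α_α
    have inj : ∀ a b, A.σ a = A.σ b → a = b := fun a b h => A.σ.injective h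
    clear h h6 hz
    unfold AtVertex IsCrossing at *
    grind
  subst this
  exact joinable_monogon_bigon_of_opposite h hz

theorem joinable_monogon_bigon (hz : A.IsMonogon z) (h : A.IsSpecialBigon x y) :
    Joinable (A.smooth z) ((A.smooth x).smooth y) := by
  by_cases hxz : A.AtVertex x z
  · exact joinable_monogon_bigon_of_atVertex h hz hxz
  by_cases hyz : A.AtVertex y z
  · exact (joinable_monogon_bigon_of_atVertex h.symm hz hyz).of_simplifies .refl
      h.smooth_comm.iso.simplifies
  refine (smooth_smooth_smooth_comm hxz hyz).iso.joinable.symm.of_simplifies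
    (h.smooth (fun k => hxz k.symm) fun k => hyz k.symm).simplifies
    ((hz.smooth hxz).smooth fun k => hyz k.of_smooth).simplifies

/-- The channel at `x` merges the two bigons into one between `y` and `w`. Each of its edges is
composed of an edge from the strand over at `x` and one from the strand under it, hence goes over at
one end and under at the other. -/
theorem isTwist_resolve (h : A.IsSpecialBigon x y) (h' : A.IsSpecialBigon (A.σ (A.σ x)) w)
    (hyw : ¬ A.AtVertex y w) (hxw : ¬ A.AtVertex x w) :
    (A.resolve x h.1 h.α_not_atVertex h.α_next_not_atVertex).IsTwist
      (toResolve y h.not_atVertex) (toResolve w hxw) := by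
  obtain ⟨h1, h2, -, h4, h5, h6, h7, h8⟩ := id h
  obtain ⟨k1, k2, -, k4, k5, k6, k7, k8⟩ := id h'
  have hxy := h.not_atVertex
  have hreg : A.reg y x := A.reg.symm ((h6 y).2 (.inr rfl))
  have inj : ∀ a b, A.σ a = A.σ b → a = b := fun a b h => A.σ.injective h
  refine ⟨(isCrossing_resolve _).2 h2, (isCrossing_resolve _).2 k2,
    fun k => hyw ((atVertex_resolve _ _).1 k), ofResolve_injective ?_, ofResolve_injective ?_,
    fun t => ?_, A.smooth_not_outer hreg h7 k7, ?_⟩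
  · have e : A.α (A.σ (A.σ x)) ≠ A.σ (A.σ (A.σ x)) := by
      rw [k4]
      exact fun k => hxw (.inr (.inr (.inl (inj _ _ k))))
    rw [ofResolve_α, ofResolve_σ, ofResolve_toResolve, ofResolve_toResolve, h5,
      if_neg (A.σ_ne x), if_pos rfl, if_neg e, k4]
  · have e : A.σ (A.σ (A.σ x)) ≠ x := fun k => A.σ_ne x (by rw [← k, A.σ_four, k])
    rw [ofResolve_α, ofResolve_σ, ofResolve_toResolve, ofResolve_toResolve, k5,
      if_neg e, if_neg fun k => h1 (inj _ _ k), if_neg (A.σ_ne _), if_pos rfl, h4]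
  · rw [resolve_reg, ← ofResolve_injective.eq_iff, ← ofResolve_injective.eq_iff,
      ofResolve_toResolve, ofResolve_toResolve, A.smooth_reg_corner_iff hreg, h6, k6]
    have hv := ofResolve_not_atVertex t
    unfold AtVertex at hv
    tauto
  · rw [resolve_isOver, resolve_isOver, ofResolve_toResolve, ofResolve_toResolve]
    have o1 := A.isOver_σ x h1
    have o2 := A.isOver_σ (A.σ x) fun k => h1 (inj _ _ k)
    have o3 := A.isOver_σ y h2
    have o4 := A.isOver_σ w k2
    rw [h4] at h8
    rw [k4] at k8
    grind

/-- A closed curve that lies over or under one strand and meets it in two crossings can be pulled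
off. -/
theorem hasSplitUnknotComponent_of_adjacent (h : A.IsSpecialBigon x y)
    (h' : A.IsSpecialBigon (A.σ x) w) : A.HasSplitUnknotComponent := by
  obtain ⟨h1, h2, -, h4, h5, h6, h7, h8⟩ := id h
  obtain ⟨k1, k2, -, k4, k5, k6, k7, k8⟩ := id h'
  have hxy := h.not_atVertex
  have f4 := A.σ_four
  have f5 := A.σ_ne
  have a1 := A.α_α
  have inj : ∀ a b, A.σ a = A.σ b → a = b := fun a b h => A.σ.injective h
  have ainj : ∀ a b, A.α a = A.α b → a = b := fun a b h => A.α.injective h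
  -- The two bigons share the edge from `σ x` to `y`, so both have the same two crossings.
  have hw : A.σ w = y := by rw [← k4, ← h5, a1]
  have e : A.α (A.σ (A.σ x)) = A.σ (A.σ (A.σ y)) := by rw [← k5, a1, ← hw, f4]
  -- After the smoothings these darts form two bivalent points joined by two edges: a circle without
  -- crossings. It misses the dart `x`, which therefore lies on another component.
  let S : A.Dart → Prop := fun t =>
    t = A.σ x ∨ t = A.σ (A.σ x) ∨ t = y ∨ t = A.σ (A.σ (A.σ y))
  let B := (A.smooth x).smooth y
  have hs : ∀ t : A.Dart, S t → S (B.σ t) ∧ B.σ (B.σ t) = t := by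
    have hB := A.smooth_smooth_σ hxy
    have s1 : B.σ (A.σ x) = A.σ (A.σ x) := by
      rw [hB]
      unfold AtVertex IsCrossing at *
      grind
    have s2 : B.σ (A.σ (A.σ x)) = A.σ x := by
      rw [hB]
      unfold AtVertex IsCrossing at *
      grind
    have s3 : B.σ y = A.σ (A.σ (A.σ y)) := by
      rw [hB, if_pos rfl]
    have s4 : B.σ (A.σ (A.σ (A.σ y))) = y := by
      rw [hB]
      unfold AtVertex IsCrossing at *
      grind
    rintro t (rfl | rfl | rfl | rfl)
    · exact ⟨.inr (.inl s1), (congrArg B.σ s1).trans s2⟩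
    · exact ⟨.inl s2, (congrArg B.σ s2).trans s1⟩
    · exact ⟨.inr (.inr (.inr s3)), (congrArg B.σ s3).trans s4⟩
    · exact ⟨.inr (.inr (.inl s4)), (congrArg B.σ s4).trans s3⟩
  have hs' : ∀ t : A.Dart, S (B.σ t) ↔ S t := by
    refine fun t => ⟨fun k => ?_, fun k => (hs t k).1⟩
    have := hs _ (hs _ (hs _ k).1).1
    have e4 : B.σ (B.σ (B.σ (B.σ t))) = t := B.σ_four t
    exact e4 ▸ this.1
  have ha : ∀ t : A.Dart, S t → S (A.α t) := by
    rintro t (rfl | rfl | rfl | rfl)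
    · exact .inr (.inr (.inl (by rw [← h5, a1])))
    · exact .inr (.inr (.inr e))
    · exact .inl h5
    · exact .inr (.inl (by rw [← e, a1]))
  have ha' : ∀ t : A.Dart, S (A.α t) ↔ S t := fun t => ⟨fun k => a1 t ▸ ha _ k, ha t⟩
  have hcomp : ∀ s t : A.Dart, t ∈ B.component s → (S s ↔ S t) := by
    intro s t hst
    induction hst with
    | rel s t k =>
      rcases k with rfl | rfl
      · exact (ha' s).symm
      · unfold opposite
        split_ifs
        · exact ((hs' _).trans (hs' _)).symm
        · exact (hs' _).symm
    | refl => exact Iff.rfl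
    | symm s t _ ih => exact ih.symm
    | trans s t r _ _ ih ih' => exact ih.trans ih'
  refine ⟨B, h.simplifies.sameLink, A.σ x, fun t ht k => k ?_, x, fun k => ?_⟩
  · exact (hs t ((hcomp _ _ ht).1 (.inl rfl))).2
  · have := (hcomp _ _ k).1 (.inl rfl)
    change x = A.σ x ∨ x = A.σ (A.σ x) ∨ x = y ∨ x = A.σ (A.σ (A.σ y)) at this
    unfold AtVertex IsCrossing at *
    grind

/-- The position of the corner `z` relative to `x` decides: the same corner gives the same bigon, an
adjacent one contradicts `hA`, and the opposite one needs either equality of opposite smoothings or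
a bigon that is not special. -/
theorem joinable_bigon_bigon_of_atVertex (hA : ¬ A.HasSplitUnknotComponent)
    (h : A.IsSpecialBigon x y) (h' : A.IsSpecialBigon z w) (hxz : A.AtVertex x z) :
    Joinable ((A.smooth x).smooth y) ((A.smooth z).smooth w) := by
  have f4 := A.σ_four
  have inj : ∀ a b, A.σ a = A.σ b → a = b := fun a b h => A.σ.injective h
  obtain ⟨h1, h2, -, h4, h5, h6, h7, h8⟩ := id h
  obtain ⟨k1, k2, -, k4, k5, k6, k7, k8⟩ := id h'
  rcases hxz with rfl | rfl | rfl | rfl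
  · have : w = y := inj _ _ (by rw [← k4, ← h4])
    subst this
    exact (Iso.refl _).joinable
  · exact absurd (hasSplitUnknotComponent_of_adjacent h h') hA
  · have hop := (A.smooth_opposite x).smooth w
    have hxw : ¬ A.AtVertex x w := fun k =>
      h'.not_atVertex (AtVertex.trans (AtVertex.symm (.inr (.inr (.inl rfl)))) k)
    refine Joinable.of_simplifies ?_ .refl hop.iso.simplifies
    -- If the second crossings coincide, the bigons are opposite there too and the smoothings agree.
    -- Otherwise both sides begin with the smoothing at `x`, and a bigon between `y` and `w`
    -- remains.
    by_cases hyw : A.AtVertex y w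
    · have hxy := h.not_atVertex
      have : w = A.σ (A.σ y) := by
        have a1 := A.α_α
        clear h h' h6 k6 hop
        unfold AtVertex IsCrossing at *
        grind
      subst this
      have e : (A.smooth x).σ ((A.smooth x).σ y) = A.σ (A.σ y) := by
        rw [smooth_σ_of_not_atVertex h.not_atVertex]
        exact smooth_σ_of_not_atVertex fun k =>
          h.not_atVertex (k.trans (AtVertex.symm (.inr (.inl rfl))))
      have := ((A.smooth x).smooth_opposite y).iso
      rw [e] at this
      exact this.symm.joinable
    · exact (isTwist_resolve h h' hyw hxw).joinable.of_simplifies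
        (simplifies_smooth_resolve h.not_atVertex) (simplifies_smooth_resolve hxw)
  · refine absurd (hasSplitUnknotComponent_of_adjacent h' (w := y) ?_) hA
    rwa [f4]

theorem joinable_bigon_bigon (hA : ¬ A.HasSplitUnknotComponent)
    (h : A.IsSpecialBigon x y) (h' : A.IsSpecialBigon z w) :
    Joinable ((A.smooth x).smooth y) ((A.smooth z).smooth w) := by
  have c := h.smooth_comm.iso.simplifies
  have c' := h'.smooth_comm.iso.simplifies
  by_cases hxz : A.AtVertex x z
  · exact joinable_bigon_bigon_of_atVertex hA h h' hxz
  by_cases hyz : A.AtVertex y z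
  · exact (joinable_bigon_bigon_of_atVertex hA h.symm h' hyz).of_simplifies c .refl
  by_cases hxw : A.AtVertex x w
  · exact (joinable_bigon_bigon_of_atVertex hA h h'.symm hxw).of_simplifies .refl c'
  by_cases hyw : A.AtVertex y w
  · exact (joinable_bigon_bigon_of_atVertex hA h.symm h'.symm hyw).of_simplifies c c'
  -- With no shared crossing, each bigon survives the opening of the other, and all four smoothings
  -- commute.
  have b := (h'.smooth hxz hxw).smooth (fun k => hyz k.of_smooth) fun k => hyw k.of_smooth
  have b' := (h.smooth (fun k => hxz k.symm) fun k => hyz k.symm).smooth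
    (fun k => hxw k.of_smooth.symm) fun k => hyw k.of_smooth.symm
  have i1 := (smooth_smooth_smooth_comm hxz hyz).smooth w
  have i2 := smooth_smooth_smooth_comm (A := A.smooth z) (x := x) (y := y) (z := w)
    (fun k => hxw k.of_smooth) fun k => hyw k.of_smooth
  exact (i1.iso.trans i2.iso).joinable.of_simplifies b.simplifies b'.simplifies

end

/-! ### Confluence up to isotopy and the theorem -/

theorem Step.joinable {A B C : LinkDiagram X} (hA : ¬ A.HasSplitUnknotComponent) (hB : Step A B)
    (hC : Step A C) : Joinable B C := by
  rcases hB with ⟨u, h, k⟩ | ⟨x, h, k⟩ | ⟨x, y, h, k⟩ <;>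
  rcases hC with ⟨u', h', k'⟩ | ⟨x', h', k'⟩ | ⟨x', y', h', k'⟩ <;>
  refine Joinable.of_simplifies ?_ k.symm.simplifies k'.symm.simplifies
  · exact A.joinable_delete_delete h h'
  · exact joinable_delete_monogon h h'
  · exact joinable_delete_bigon h h'
  · exact (joinable_delete_monogon h' h).symm
  · exact joinable_monogon_monogon h h'
  · exact joinable_monogon_bigon h h'
  · exact (joinable_delete_bigon h' h).symm
  · exact (joinable_monogon_bigon h' h).symm
  · exact joinable_bigon_bigon hA h h'

/-- The two common simplifications are both simplifications of `B`, so confluence below `B` joins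
them. -/
theorem Joinable.trans {A B C : LinkDiagram X} (hB : ¬ B.HasSplitUnknotComponent)
    (h : Joinable A B) (h' : Joinable B C) : Joinable A C := by
  obtain ⟨M, h1, h2⟩ := h
  obtain ⟨N, h3, h4⟩ := h'
  exact (confluent_of_locally_confluent (fun _ _ _ => Step.joinable) B M N hB h2 h3).of_simplifies
    h1 h4

theorem Isotopic.sameLink {A B : LinkDiagram X} (h : Isotopic A B) : SameLink A B :=
  .rel _ _ (.inl h)

theorem Isotopic.joinable {A B : LinkDiagram X} (h : Isotopic A B)
    (hA : ¬ A.HasSplitUnknotComponent) : Joinable A B := by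
  induction h with
  | rel A B h =>
    rcases h with h | h
    · exact h.joinable
    · obtain ⟨u, hu, k⟩ := h.exists_delete
      exact (Simplifies.joinable ((simplifies_delete B hu).trans k.simplifies)).symm
  | refl A => exact (Iso.refl A).joinable
  | symm A B h ih =>
    exact (ih fun k => hA (SameLink.hasSplitUnknotComponent
      (.symm _ _ (Isotopic.sameLink h)) k)).symm
  | trans A B C h h' ih ih' =>
    have hB : ¬ B.HasSplitUnknotComponent := fun k =>
      hA ((Isotopic.sameLink h).hasSplitUnknotComponent k)
    exact (ih hA).trans hB (ih' hB)

theorem Reduces.sameLink {A B : LinkDiagram X} (h : Reduces A B) : SameLink A B :=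
  .rel _ _ (.inr (h.imp id .inl))

theorem Reduces.joinable {A B : LinkDiagram X} (h : Reduces A B)
    (hA : ¬ A.HasSplitUnknotComponent) : Joinable A B := by
  have key : ∀ E F : LinkDiagram X, Isotopic A E → Step E F → Isotopic F B → Joinable A B := by
    intro E F h1 h2 h3
    have hE : ¬ E.HasSplitUnknotComponent := fun k =>
      hA (h1.sameLink.hasSplitUnknotComponent k)
    have hF : ¬ F.HasSplitUnknotComponent := fun k =>
      hE (h2.sameLink.hasSplitUnknotComponent k)
    exact (h1.joinable hA).trans hE (h2.simplifies.joinable.trans hF (h3.joinable hF))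
  rcases h with ⟨E, x, h1, h2, h3⟩ | ⟨E, x, y, h1, h2, h3⟩
  · exact key E _ h1 (.inr (.inl ⟨x, h2, .refl _⟩)) h3
  · exact key E _ h1 (.inr (.inr ⟨x, y, h2, .refl _⟩)) h3

theorem joinable_of_reduces {A B : LinkDiagram X} (h : Relation.ReflTransGen Reduces A B)
    (hA : ¬ A.HasSplitUnknotComponent) : Joinable A B := by
  induction h using Relation.ReflTransGen.head_induction_on with
  | refl => exact (Iso.refl B).joinable
  | head h _ ih =>
    have hC := fun k => hA (h.sameLink.hasSplitUnknotComponent k)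
    exact (h.joinable hA).trans hC (ih hC)

/-- The moves allow an isotopy beforehand. As long as only points have been forgotten, a monogon or
special bigon further down would give a move on `A` itself. -/
theorem IsMinimal.isotopic_of_simplifies {A B : LinkDiagram X} (hA : A.IsMinimal)
    (h : Simplifies A B) : Isotopic A B := by
  induction h with
  | refl => exact .refl _
  | tail _ h ih =>
    refine .trans _ _ _ ih ?_
    rcases h with (⟨u, h, k⟩ | ⟨x, h, k⟩ | ⟨x, y, h, k⟩) | h
    · exact .trans _ _ _ (isotopic_delete _ h) k.isotopic
    · exact absurd (.inl ⟨_, x, ih, h, k.isotopic⟩) (hA _)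
    · exact absurd (.inr ⟨_, x, y, ih, h, k.isotopic⟩) (hA _)
    · exact h.isotopic

end LinkDiagram

theorem theorem1 (X : Ambient) (D D₁ D₂ : LinkDiagram X)
    (hD : ¬ D.HasSplitUnknotComponent)
    (h₁ : Relation.ReflTransGen LinkDiagram.Reduces D D₁) (hm₁ : D₁.IsMinimal)
    (h₂ : Relation.ReflTransGen LinkDiagram.Reduces D D₂) (hm₂ : D₂.IsMinimal) :
    LinkDiagram.Isotopic D₁ D₂ := by
  obtain ⟨C, k₁, k₂⟩ := (LinkDiagram.joinable_of_reduces h₁ hD).symm.trans hD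
    (LinkDiagram.joinable_of_reduces h₂ hD)
  exact .trans _ _ _ (hm₁.isotopic_of_simplifies k₁) (.symm _ _ (hm₂.isotopic_of_simplifies k₂))
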